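/- Let $N\in\mathbb N$ and let $\omega:[0,\infty)\to[0,\infty)$ be a non-quasianalytic weight function, i.e. $\omega$ is continuous and increasing (not necessarily strictly) and ($\alpha$) there is $K\ge 1$ with $\omega(2t)\le K(1+\omega(t))$ for all $t\ge 0$; ($\beta$) $\int_1^\infty \frac{\omega(t)}{1+t^2}\,dt<\infty$; ($\gamma$) there are $a\in\mathbb R$, $b>0$ with $\omega(t)\ge a+b\log(1+t)$ for all $t\ge0$; ($\delta$) $t\mapsto\omega(e^t)$ is convex on $\mathbb R$. Write $\omega(x)=\omega(|x|)$ for $x\in\mathbb R^N$, and $\varphi^*_\omega(s)=\sup_{t\ge0}\{st-\omega(e^t)\}\in(-\infty,\infty]$ for $s\ge 0$, with $\exp(-\infty)=0$. For positive integers $m,n$ let $\mathcal O^m_{n,\omega}(\mathbb R^N)$ be the space of all complex-valued $f\in C^\infty(\mathbb R^N)$ with $$r_{m,n}(f)=\sup_{\alpha\in\mathbb N_0^N}\sup_{x\in\mathbb R^N}|\partial^\alpha f(x)|\exp\Big(-n\omega(x)-m\varphi^*_\omega\big(\tfrac{|\alpha|}{m}\big)\Big)<\infty,$$ normed by $r_{m,n}$.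 Let $\mathcal O^m_\omega=\operatorname{ind}_{n}\mathcal O^m_{n,\omega}$ be the locally convex inductive limit, and let $$\mathcal O_{M,\omega}(\mathbb R^N)=\bigcap_{m\ge1}\bigcup_{n\ge1}\mathcal O^m_{n,\omega}(\mathbb R^N)$$ carry the projective limit topology $\operatorname{proj}_m\operatorname{ind}_n\mathcal O^m_{n,\omega}$. Let $\mathcal S_\omega(\mathbb R^N)$ be the set of all $f\in L^1(\mathbb R^N)$ with $f,\hat f\in C^\infty(\mathbb R^N)$ such that $e^{\lambda\omega}\partial^\alpha f$ and $e^{\lambda\omega}\partial^\alpha\hat f$ are bounded for all $\lambda>0$ and $\alpha\in\mathbb N_0^N$. For $k\in\mathcal S_\omega(\mathbb R^N)$ and $m\ge 1$ put $$q_{m,k}(f)=\sup_{\alpha\in\mathbb N_0^N}\sup_{x\in\mathbb R^N}|k(x)|\,|\partial^\alpha f(x)|\exp\Big(-m\varphi^*_\omega\big(\tfrac{|\alpha|}{m}\big)\Big).$$ Then $\mathcal O_{M,\omega}(\mathbb R^N)$ is a locally convex Hausdorff space, the product $fg$ of two of its elements belongs to it again, and pointwise multiplication is an associative, jointly continuous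 bilinear map $$\mathcal O_{M,\omega}(\mathbb R^N)\times\mathcal O_{M,\omega}(\mathbb R^N)\to\mathcal O_{M,\omega}(\mathbb R^N),\qquad (f,g)\mapsto fg;$$ that is, $(\mathcal O_{M,\omega}(\mathbb R^N),\cdot)$ is a topological algebra. Moreover, every $q_{m,k}$ is finite on $\mathcal O_{M,\omega}(\mathbb R^N)$; for every $k\in\mathcal S_\omega(\mathbb R^N)$ there is $l\in\mathcal S_\omega(\mathbb R^N)$, $l\ge0$, with $|k|\le l^2$; and for every $m\ge1$ there are $m'\ge 1$ and $C\ge0$ such that $$q_{m,k}(fg)\le C\,q_{m',l}(f)\,q_{m',l}(g)$$ for all $f,g\in\mathcal O_{M,\omega}(\mathbb R^N)$, all $k\in\mathcal S_\omega(\mathbb R^N)$ and all real-valued $l\in\mathcal S_\omega(\mathbb R^N)$ with $|k|\le l^2$. -/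

import Mathlib

open scoped NNReal ENNReal FourierTransform

noncomputable section

namespace UltraMult

/-- `ℝ^N` with the Euclidean norm. -/
abbrev E (N : ℕ) : Type := EuclideanSpace ℝ (Fin N)

/-- Non-quasianalytic weight functions `ω : [0,∞) → [0,∞)`; only the values of `ω` on `[0,∞)`
are ever used. -/
structure IsNonquasianalyticWeight (ω : ℝ → ℝ) : Prop where
  continuousOn : ContinuousOn ω (Set.Ici 0)
  monotoneOn : MonotoneOn ω (Set.Ici 0)
  nonneg : ∀ t, 0 ≤ t → 0 ≤ ω t
  alpha : ∃ K : ℝ, 1 ≤ K ∧ ∀ t, 0 ≤ t → ω (2 * t) ≤ K * (1 + ω t)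
  beta : MeasureTheory.IntegrableOn (fun t => ω t / (1 + t ^ 2)) (Set.Ioi 1)
  gamma : ∃ a b : ℝ, 0 < b ∧ ∀ t, 0 ≤ t → a + b * Real.log (1 + t) ≤ ω t
  delta : ConvexOn ℝ Set.univ (fun t => ω (Real.exp t))

/-- The Young conjugate `φ*_ω(s) = sup_{t ≥ 0} (s t - ω(e^t))`. It is extended-real valued: for
`ω(t) = log(1+t)`, for instance, it is `+∞` for all `s > 1`. -/
def youngConj (ω : ℝ → ℝ) (s : ℝ) : EReal :=
  ⨆ t : ℝ≥0, ((s * (t : ℝ) - ω (Real.exp (t : ℝ)) : ℝ) : EReal)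

/-- The factor `exp (c - m φ*_ω(k / m))`, with `exp (-∞) = 0`. -/
def expWeight (ω : ℝ → ℝ) (c : ℝ) (m : ℕ+) (k : ℕ) : ℝ≥0∞ :=
  EReal.exp ((c : EReal) - ((m : ℝ) : EReal) * youngConj ω ((k : ℝ) / (m : ℝ)))

variable {N : ℕ}

/-- The partial derivative `∂f/∂x_i`. -/
def partialDeriv (i : Fin N) (f : E N → ℂ) : E N → ℂ :=
  fun x => fderiv ℝ f x (EuclideanSpace.single i (1 : ℝ))

/-- `∂^α f = ∂_1^{α_1} ⋯ ∂_N^{α_N} f` for a multi-index `α`. -/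
def multiDeriv (α : Fin N → ℕ) (f : E N → ℂ) : E N → ℂ :=
  (List.finRange N).foldr (fun i g => (partialDeriv i)^[α i] g) f

/-- The length `|α|` of a multi-index. -/
def len (α : Fin N → ℕ) : ℕ := ∑ i, α i

/-- `r_{m,n}(f) = sup_α sup_x |∂^α f(x)| exp(-n ω(x) - m φ*_ω(|α|/m))`, in `[0,∞]`. -/
def r (ω : ℝ → ℝ) (m n : ℕ+) (f : E N → ℂ) : ℝ≥0∞ :=
  ⨆ (α : Fin N → ℕ) (x : E N),
    ‖multiDeriv α f x‖ₑ * expWeight ω (-((n : ℝ) * ω ‖x‖)) m (len α)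

/-- `q_{m,g}(f) = sup_α sup_x |g(x)| |∂^α f(x)| exp(-m φ*_ω(|α|/m))`, in `[0,∞]`. -/
def q (ω : ℝ → ℝ) (m : ℕ+) (g f : E N → ℂ) : ℝ≥0∞ :=
  ⨆ (α : Fin N → ℕ) (x : E N), ‖g x‖ₑ * ‖multiDeriv α f x‖ₑ * expWeight ω 0 m (len α)

/-- Membership in `S_ω(ℝ^N)`. By condition `(α)` on `ω` the normalization of the Fourier transform
does not matter. -/
structure MemS (ω : ℝ → ℝ) (f : E N → ℂ) : Prop where
  integrable : MeasureTheory.Integrable f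
  smooth : ContDiff ℝ (⊤ : ℕ∞) f
  smooth_fourier : ContDiff ℝ (⊤ : ℕ∞) (𝓕 f)
  decay : ∀ lam : ℝ, 0 < lam → ∀ α : Fin N → ℕ,
    ∃ C : ℝ, ∀ x, Real.exp (lam * ω ‖x‖) * ‖multiDeriv α f x‖ ≤ C
  decay_fourier : ∀ lam : ℝ, 0 < lam → ∀ α : Fin N → ℕ,
    ∃ C : ℝ, ∀ x, Real.exp (lam * ω ‖x‖) * ‖multiDeriv α (𝓕 f) x‖ ≤ C

/-! Linearity of `∂^α` on smooth functions and the seminorm properties of `r_{m,n}`. -/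

theorem partialDeriv_smooth (i : Fin N) {f : E N → ℂ} (hf : ContDiff ℝ (⊤ : ℕ∞) f) :
    ContDiff ℝ (⊤ : ℕ∞) (partialDeriv i f) := by
  have h : ContDiff ℝ (⊤ : ℕ∞) (fderiv ℝ f) := hf.fderiv_right (by simp)
  exact h.clm_apply contDiff_const

theorem partialDeriv_add (i : Fin N) {f g : E N → ℂ} (hf : ContDiff ℝ (⊤ : ℕ∞) f)
    (hg : ContDiff ℝ (⊤ : ℕ∞) g) : partialDeriv i (f + g) = partialDeriv i f + partialDeriv i g := by
  funext x
  have h1 : DifferentiableAt ℝ f x := hf.differentiable (by simp) x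
  have h2 : DifferentiableAt ℝ g x := hg.differentiable (by simp) x
  simp [partialDeriv, fderiv_add h1 h2]

theorem partialDeriv_smul (i : Fin N) (c : ℂ) {f : E N → ℂ} (hf : ContDiff ℝ (⊤ : ℕ∞) f) :
    partialDeriv i (c • f) = c • partialDeriv i f := by
  funext x
  have h1 : DifferentiableAt ℝ f x := hf.differentiable (by simp) x
  simp [partialDeriv, fderiv_const_smul h1 c]

theorem iter_smooth (i : Fin N) (k : ℕ) {f : E N → ℂ} (hf : ContDiff ℝ (⊤ : ℕ∞) f) :
    ContDiff ℝ (⊤ : ℕ∞) ((partialDeriv i)^[k] f) := by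
  induction k generalizing f with
  | zero => exact hf
  | succ k ih => exact ih (partialDeriv_smooth i hf)

theorem iter_add (i : Fin N) (k : ℕ) {f g : E N → ℂ} (hf : ContDiff ℝ (⊤ : ℕ∞) f)
    (hg : ContDiff ℝ (⊤ : ℕ∞) g) :
    (partialDeriv i)^[k] (f + g) = (partialDeriv i)^[k] f + (partialDeriv i)^[k] g := by
  induction k generalizing f g with
  | zero => rfl
  | succ k ih =>
    simp only [Function.iterate_succ_apply, partialDeriv_add i hf hg]
    exact ih (partialDeriv_smooth i hf) (partialDeriv_smooth i hg)

theorem iter_smul (i : Fin N) (k : ℕ) (c : ℂ) {f : E N → ℂ} (hf : ContDiff ℝ (⊤ : ℕ∞) f) :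
    (partialDeriv i)^[k] (c • f) = c • (partialDeriv i)^[k] f := by
  induction k generalizing f with
  | zero => rfl
  | succ k ih =>
    simp only [Function.iterate_succ_apply, partialDeriv_smul i c hf]
    exact ih (partialDeriv_smooth i hf)

theorem foldr_smooth (α : Fin N → ℕ) (L : List (Fin N)) {f : E N → ℂ} (hf : ContDiff ℝ (⊤ : ℕ∞) f) :
    ContDiff ℝ (⊤ : ℕ∞) (L.foldr (fun i g => (partialDeriv i)^[α i] g) f) := by
  induction L with
  | nil => exact hf
  | cons i L ih => exact iter_smooth i _ ih

theorem multiDeriv_smooth (α : Fin N → ℕ) {f : E N → ℂ} (hf : ContDiff ℝ (⊤ : ℕ∞) f) :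
    ContDiff ℝ (⊤ : ℕ∞) (multiDeriv α f) := foldr_smooth α _ hf

theorem multiDeriv_add (α : Fin N → ℕ) {f g : E N → ℂ} (hf : ContDiff ℝ (⊤ : ℕ∞) f)
    (hg : ContDiff ℝ (⊤ : ℕ∞) g) : multiDeriv α (f + g) = multiDeriv α f + multiDeriv α g := by
  unfold multiDeriv
  induction List.finRange N with
  | nil => rfl
  | cons i L ih =>
    simp only [List.foldr_cons, ih]
    exact iter_add i _ (foldr_smooth α L hf) (foldr_smooth α L hg)

theorem multiDeriv_smul (α : Fin N → ℕ) (c : ℂ) {f : E N → ℂ} (hf : ContDiff ℝ (⊤ : ℕ∞) f) :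
    multiDeriv α (c • f) = c • multiDeriv α f := by
  unfold multiDeriv
  induction List.finRange N with
  | nil => rfl
  | cons i L ih =>
    simp only [List.foldr_cons, ih]
    exact iter_smul i _ c (foldr_smooth α L hf)

theorem r_add_le (ω : ℝ → ℝ) (m n : ℕ+) {f g : E N → ℂ} (hf : ContDiff ℝ (⊤ : ℕ∞) f)
    (hg : ContDiff ℝ (⊤ : ℕ∞) g) : r ω m n (f + g) ≤ r ω m n f + r ω m n g := by
  refine iSup₂_le fun α x => ?_
  rw [multiDeriv_add α hf hg]
  calc _ ≤ (‖multiDeriv α f x‖ₑ + ‖multiDeriv α g x‖ₑ) *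
        expWeight ω (-((n : ℝ) * ω ‖x‖)) m (len α) := by
        gcongr; exact enorm_add_le _ _
    _ ≤ _ := by
        rw [add_mul]
        exact add_le_add
          (le_iSup₂ (f := fun (α : Fin N → ℕ) (x : E N) => ‖multiDeriv α f x‖ₑ *
            expWeight ω (-((n : ℝ) * ω ‖x‖)) m (len α)) α x)
          (le_iSup₂ (f := fun (α : Fin N → ℕ) (x : E N) => ‖multiDeriv α g x‖ₑ *
            expWeight ω (-((n : ℝ) * ω ‖x‖)) m (len α)) α x)

theorem r_smul (ω : ℝ → ℝ) (m n : ℕ+) (c : ℂ) {f : E N → ℂ} (hf : ContDiff ℝ (⊤ : ℕ∞) f) :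
    r ω m n (c • f) = ‖c‖ₑ * r ω m n f := by
  simp only [r, multiDeriv_smul _ c hf, Pi.smul_apply, enorm_smul, ENNReal.mul_iSup, mul_assoc]

theorem r_zero (ω : ℝ → ℝ) (m n : ℕ+) : r ω m n (0 : E N → ℂ) = 0 := by
  have h := r_smul (N := N) ω m n 0 (f := 0) contDiff_const
  simpa using h

theorem r_anti (ω : ℝ → ℝ) (m : ℕ+) {n n' : ℕ+} (h : n ≤ n') (hω : ∀ t, 0 ≤ t → 0 ≤ ω t)
    (f : E N → ℂ) : r ω m n' f ≤ r ω m n f := by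
  refine iSup₂_mono fun α x => ?_
  gcongr
  refine EReal.exp_monotone (EReal.sub_le_sub ?_ le_rfl)
  have h1 : (n : ℝ) ≤ n' := by exact_mod_cast h
  exact_mod_cast neg_le_neg (mul_le_mul_of_nonneg_right h1 (hω _ (norm_nonneg x)))

/-- The underlying vector space of `O^m_{n,ω}(ℝ^N)`. -/
def stepSubmodule (N : ℕ) (ω : ℝ → ℝ) (m n : ℕ+) : Submodule ℂ (E N → ℂ) where
  carrier := {f | ContDiff ℝ (⊤ : ℕ∞) f ∧ r ω m n f < ∞}
  zero_mem' := ⟨contDiff_const, by rw [r_zero]; exact ENNReal.zero_lt_top⟩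
  add_mem' := fun hf hg => ⟨hf.1.add hg.1,
    (r_add_le ω m n hf.1 hg.1).trans_lt (ENNReal.add_lt_top.2 ⟨hf.2, hg.2⟩)⟩
  smul_mem' := fun c f hf => ⟨hf.1.const_smul c, by
    rw [r_smul ω m n c hf.1]; exact ENNReal.mul_lt_top enorm_lt_top hf.2⟩

/-- `O^m_{n,ω}(ℝ^N)`, normed by `r_{m,n}`. -/
def StepSpace (N : ℕ) (ω : ℝ → ℝ) (m n : ℕ+) : Type := ↥(stepSubmodule N ω m n)

instance (ω : ℝ → ℝ) (m n : ℕ+) : AddCommGroup (StepSpace N ω m n) :=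
  inferInstanceAs (AddCommGroup ↥(stepSubmodule N ω m n))

instance (ω : ℝ → ℝ) (m n : ℕ+) : Module ℂ (StepSpace N ω m n) :=
  inferInstanceAs (Module ℂ ↥(stepSubmodule N ω m n))

/-- The norm `r_{m,n}` on `O^m_{n,ω}(ℝ^N)`. -/
def stepNorm (N : ℕ) (ω : ℝ → ℝ) (m n : ℕ+) : Seminorm ℂ (StepSpace N ω m n) :=
  Seminorm.of (fun f => (r ω m n f.1).toReal)
    (fun f g => by
      rw [← ENNReal.toReal_add f.2.2.ne g.2.2.ne]
      exact ENNReal.toReal_mono (ENNReal.add_lt_top.2 ⟨f.2.2, g.2.2⟩).ne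
        (r_add_le ω m n f.2.1 g.2.1))
    (fun c f => by
      have h : r ω m n (c • f).1 = ‖c‖ₑ * r ω m n f.1 := r_smul ω m n c f.2.1
      rw [h, ENNReal.toReal_mul, toReal_enorm])

instance (ω : ℝ → ℝ) (m n : ℕ+) : SeminormedAddCommGroup (StepSpace N ω m n) :=
  (stepNorm N ω m n).toAddGroupSeminorm.toSeminormedAddCommGroup

/-- The underlying vector space `⋃_n O^m_{n,ω}(ℝ^N)` of `O^m_ω(ℝ^N)`, written as a supremum of
subspaces; for a weight function the spaces increase with `n`, so this is the union. -/
def indSubmodule (N : ℕ) (ω : ℝ → ℝ) (m : ℕ+) : Submodule ℂ (E N → ℂ) :=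
  ⨆ n : ℕ+, stepSubmodule N ω m n

theorem mem_indSubmodule {ω : ℝ → ℝ} (hω : ∀ t, 0 ≤ t → 0 ≤ ω t) {m : ℕ+} {f : E N → ℂ} :
    f ∈ indSubmodule N ω m ↔ ∃ n : ℕ+, ContDiff ℝ (⊤ : ℕ∞) f ∧ r ω m n f < ∞ := by
  have hd : Directed (· ≤ ·) (stepSubmodule N ω m) :=
    Monotone.directed_le fun _ _ h f hf => ⟨hf.1, (r_anti ω m h hω f).trans_lt hf.2⟩
  exact Submodule.mem_iSup_of_directed _ hd

/-- `O^m_ω(ℝ^N) = ind_n O^m_{n,ω}(ℝ^N)`. -/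
def IndSpace (N : ℕ) (ω : ℝ → ℝ) (m : ℕ+) : Type := ↥(indSubmodule N ω m)

instance (ω : ℝ → ℝ) (m : ℕ+) : AddCommGroup (IndSpace N ω m) :=
  inferInstanceAs (AddCommGroup ↥(indSubmodule N ω m))

instance (ω : ℝ → ℝ) (m : ℕ+) : Module ℂ (IndSpace N ω m) :=
  inferInstanceAs (Module ℂ ↥(indSubmodule N ω m))

instance (ω : ℝ → ℝ) (m : ℕ+) : Module ℝ (IndSpace N ω m) :=
  inferInstanceAs (Module ℝ ↥(indSubmodule N ω m))

/-- The inclusion `O^m_{n,ω}(ℝ^N) → O^m_ω(ℝ^N)`. -/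
def stepIncl (N : ℕ) (ω : ℝ → ℝ) (m n : ℕ+) (f : StepSpace N ω m n) : IndSpace N ω m :=
  ⟨f.1, Submodule.mem_iSup_of_mem n f.2⟩

/-- The locally convex inductive limit topology: the finest locally convex vector space topology
for which all inclusions `O^m_{n,ω} → O^m_ω` are continuous. -/
instance (ω : ℝ → ℝ) (m : ℕ+) : TopologicalSpace (IndSpace N ω m) :=
  sInf {t | @IsTopologicalAddGroup (IndSpace N ω m) t _ ∧
    @ContinuousSMul ℂ (IndSpace N ω m) _ _ t ∧
    @LocallyConvexSpace ℝ (IndSpace N ω m) _ _ _ _ t ∧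
    ∀ n : ℕ+, @Continuous _ _ inferInstance t (stepIncl N ω m n)}

/-- The underlying vector space `⋂_m ⋃_n O^m_{n,ω}(ℝ^N)` of `O_{M,ω}(ℝ^N)`. -/
def omSubmodule (N : ℕ) (ω : ℝ → ℝ) : Submodule ℂ (E N → ℂ) :=
  ⨅ m : ℕ+, indSubmodule N ω m

/-- `O_{M,ω}(ℝ^N) = proj_m ind_n O^m_{n,ω}(ℝ^N)`. -/
def OM (N : ℕ) (ω : ℝ → ℝ) : Type := ↥(omSubmodule N ω)

instance (ω : ℝ → ℝ) : AddCommGroup (OM N ω) :=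
  inferInstanceAs (AddCommGroup ↥(omSubmodule N ω))

instance (ω : ℝ → ℝ) : Module ℂ (OM N ω) :=
  inferInstanceAs (Module ℂ ↥(omSubmodule N ω))

instance (ω : ℝ → ℝ) : Module ℝ (OM N ω) :=
  inferInstanceAs (Module ℝ ↥(omSubmodule N ω))

instance (ω : ℝ → ℝ) : CoeFun (OM N ω) (fun _ => E N → ℂ) := ⟨fun f => f.1⟩

/-- The inclusion `O_{M,ω}(ℝ^N) → O^m_ω(ℝ^N)`. -/
def omIncl (N : ℕ) (ω : ℝ → ℝ) (m : ℕ+) (f : OM N ω) : IndSpace N ω m :=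
  ⟨f.1, (Submodule.mem_iInf _).1 f.2 m⟩

/-- The projective limit topology: the coarsest topology for which all inclusions
`O_{M,ω} → O^m_ω` are continuous. -/
instance (ω : ℝ → ℝ) : TopologicalSpace (OM N ω) :=
  ⨅ m : ℕ+, TopologicalSpace.induced (omIncl N ω m) inferInstance

end UltraMult

end

open UltraMult
open scoped NNReal ENNReal

/-!
The continuity of multiplication and the estimate for the seminorms `q_{m,k}` both rest on a
weighted Leibniz estimate (`enorm_multiDeriv_mul_le`). The number of terms in the Leibniz
expansion of `∂^α (f g)` is `2^|α|`, counted with multiplicity. Since `φ*` is superadditive on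
`[0,∞)` and condition `(α)` lets one trade a dilation by `2` in the argument of `ω` for a larger
index `m'`, the factor `2^|α|` is absorbed by the weights (`exists_two_pow_mul_expWeight_le`).
Hence multiplication maps `O^{m'}_i × O^{m'}_j` to `O^m_{i+j}` with a norm bound independent of
`i` and `j` (`exists_r_mul_le`), and the estimate for the seminorms `q_{m,k}` follows in the same
way (`exists_q_mul_le`).

For the inductive limits, a seminorm on `O^m_ω` is continuous exactly when it is at most
`c n` times the norm on the `n`-th step for some constants `c n`. Given a continuous seminorm `p` on
`O^m_ω` with constants `c`, choose `d n ≥ 1` with `C c (i+j) ≤ d i d j`, which is possible as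
`i + j ≤ 2 max i j`. Let `p'` be the largest seminorm on `O^{m'}_ω` that is at most `d n` times the
norm on each step. Fixing one factor at a time shows `p (f g) ≤ p' f * p' g`
(`exists_mul_continuous`), so multiplication is jointly continuous already on the inductive
limits, and hence on their projective limit. Point evaluations are continuous, which gives the
Hausdorff property.

For `k ∈ S_ω`, let `h` be a radially decreasing majorant of `√|k|`, shifted outwards by `1`. A
multiple `l` of the convolution of `h` with the Gaussian `e^(-π|x|²)` satisfies `|k| ≤ l²`. Both `l`
and its Fourier transform decay like `e^(-λω)` for all `λ`, since `ω(t) = O(1+t)` by condition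
`(β)` and the Gaussian is its own Fourier transform. That such decay of a function and its Fourier
transform forces the decay of all derivatives (`memS_of_decays`) is a Landau–Kolmogorov argument:
all derivatives are bounded by Fourier inversion, and a Taylor expansion with step `e^(-λω(x))`
then makes the first derivatives inherit the decay of the function.
-/

noncomputable section

namespace UltraMult

open MeasureTheory

variable {N : ℕ}

/-! ### The weights `exp (c - m φ*(k/m))` -/

theorem expWeight_le (ω : ℝ → ℝ) (c : ℝ) (m : ℕ+) (k : ℕ) (t : ℝ≥0) :
    expWeight ω c m k ≤
      ENNReal.ofReal (Real.exp (c - (k * (t : ℝ) - m * ω (Real.exp (t : ℝ))))) := by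
  rw [← EReal.exp_coe]
  refine EReal.exp_monotone ?_
  have hm : (0 : ℝ) < m := by exact_mod_cast m.pos
  have h1 : (((k : ℝ) / m * (t : ℝ) - ω (Real.exp t) : ℝ) : EReal) ≤ youngConj ω ((k : ℝ) / m) :=
    le_iSup (fun t : ℝ≥0 => (((k : ℝ) / m * (t : ℝ) - ω (Real.exp (t : ℝ)) : ℝ) : EReal)) t
  have h2 : ((m : ℝ) : EReal) * (((k : ℝ) / m * (t : ℝ) - ω (Real.exp t) : ℝ) : EReal) ≤
      ((m : ℝ) : EReal) * youngConj ω ((k : ℝ) / m) :=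
    mul_le_mul_of_nonneg_left h1 (by exact_mod_cast hm.le)
  rw [← EReal.coe_mul] at h2
  have h3 : (m : ℝ) * ((k : ℝ) / m * (t : ℝ) - ω (Real.exp t)) =
      k * (t : ℝ) - m * ω (Real.exp (t : ℝ)) := by field_simp
  rw [h3] at h2
  rw [EReal.coe_sub c]
  exact EReal.sub_le_sub le_rfl h2

theorem le_expWeight {ω : ℝ → ℝ} {c : ℝ} {m : ℕ+} {k : ℕ} {a : ℝ≥0∞}
    (h : ∀ t : ℝ≥0, a ≤
      ENNReal.ofReal (Real.exp (c - (k * (t : ℝ) - m * ω (Real.exp (t : ℝ)))))) :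
    a ≤ expWeight ω c m k := by
  have hm : (0 : ℝ) < m := by exact_mod_cast m.pos
  obtain ⟨y, rfl⟩ : ∃ y, EReal.exp y = a := ⟨ENNReal.log a, ENNReal.exp_log a⟩
  simp only [← EReal.exp_coe, EReal.exp_le_exp_iff] at h
  refine EReal.exp_monotone ?_
  induction y with
  | bot => exact bot_le
  | top => exact absurd (top_le_iff.1 (h 0)) (EReal.coe_ne_top _)
  | coe y =>
    have h1 : youngConj ω ((k : ℝ) / m) ≤ (((c - y) / m : ℝ) : EReal) := by
      refine iSup_le fun t => ?_
      have h2 := EReal.coe_le_coe_iff.1 (h t)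
      refine EReal.coe_le_coe_iff.2 ?_
      rw [le_div_iff₀ hm]
      have h3 : ((k : ℝ) / m * (t : ℝ) - ω (Real.exp t)) * m =
        k * (t : ℝ) - m * ω (Real.exp (t : ℝ)) := by field_simp
      rw [h3]; linarith
    have h4 : ((m : ℝ) : EReal) * youngConj ω ((k : ℝ) / m) ≤ ((c - y : ℝ) : EReal) := by
      refine (mul_le_mul_of_nonneg_left h1 (by exact_mod_cast hm.le)).trans (le_of_eq ?_)
      rw [← EReal.coe_mul]; congr 1; field_simp
    have h5 : ((y : ℝ) : EReal) = (c : EReal) - ((c - y : ℝ) : EReal) := by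
      rw [← EReal.coe_sub]; congr 1; ring
    rw [h5]
    exact EReal.sub_le_sub le_rfl h4

/-- The weights as infima of exponentials; this also covers the value `φ* = ∞`. -/
theorem expWeight_eq_iInf (ω : ℝ → ℝ) (c : ℝ) (m : ℕ+) (k : ℕ) :
    expWeight ω c m k = ⨅ t : ℝ≥0,
      ENNReal.ofReal (Real.exp (c - (k * (t : ℝ) - m * ω (Real.exp (t : ℝ))))) :=
  le_antisymm (le_iInf (expWeight_le ω c m k)) (le_expWeight fun t => iInf_le _ t)

theorem expWeight_ne_top (ω : ℝ → ℝ) (c : ℝ) (m : ℕ+) (k : ℕ) : expWeight ω c m k ≠ ∞ :=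
  ne_top_of_le_ne_top ENNReal.ofReal_ne_top (expWeight_le ω c m k 0)

/-- Since `φ*(0) = -ω(1)`, the weight of order zero is bounded below. -/
theorem le_expWeight_zero {ω : ℝ → ℝ} (hω : ∀ t, 0 ≤ t → 0 ≤ ω t) (c : ℝ) (m : ℕ+) :
    ENNReal.ofReal (Real.exp c) ≤ expWeight ω c m 0 := by
  refine le_expWeight fun t => ENNReal.ofReal_le_ofReal (Real.exp_le_exp.2 ?_)
  have h1 : (0 : ℝ) ≤ m * ω (Real.exp (t : ℝ)) := mul_nonneg (by positivity) (hω _ (by positivity))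
  simp only [Nat.cast_zero, zero_mul]; linarith

theorem expWeight_eq_mul (ω : ℝ → ℝ) (c d : ℝ) (m : ℕ+) (k : ℕ) :
    expWeight ω (c + d) m k = ENNReal.ofReal (Real.exp c) * expWeight ω d m k := by
  rw [expWeight_eq_iInf, expWeight_eq_iInf, ENNReal.mul_iInf_of_ne (by simp [Real.exp_pos]) (by simp)]
  congr 1; funext t
  rw [← ENNReal.ofReal_mul (Real.exp_pos _).le, ← Real.exp_add, ← add_sub_assoc]

/-- Superadditivity of `φ*` together with the absorption of the factor `2^(a+b)`: by condition
`(α)`, passing from `m` to a large `m'` gains a dilation of the variable of `ω` by `2`. -/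
theorem exists_two_pow_mul_expWeight_le {ω : ℝ → ℝ} (hω : IsNonquasianalyticWeight ω) (m : ℕ+) :
    ∃ (m' : ℕ+) (C : ℝ≥0), ∀ (c d : ℝ) (a b : ℕ),
      2 ^ (a + b) * expWeight ω (c + d) m (a + b) ≤
        C * (expWeight ω c m' a * expWeight ω d m' b) := by
  obtain ⟨K, hK, hα⟩ := hω.alpha
  obtain ⟨M, hM⟩ := exists_nat_ge (m * K)
  have hm : (0 : ℝ) < m := by exact_mod_cast m.pos
  have hMpos : 0 < M := by
    have : (0 : ℝ) < M := lt_of_lt_of_le (by positivity) hM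
    exact_mod_cast this
  let m' : ℕ+ := ⟨M, hMpos⟩
  refine ⟨m', (Real.exp M).toNNReal, fun c d a b => ?_⟩
  have key : ∀ s t : ℝ≥0, (2 : ℝ≥0∞) ^ (a + b) * expWeight ω (c + d) m (a + b) ≤
      ENNReal.ofReal (Real.exp M) *
        (ENNReal.ofReal (Real.exp (c - (a * (s : ℝ) - M * ω (Real.exp (s : ℝ))))) *
        ENNReal.ofReal (Real.exp (d - (b * (t : ℝ) - M * ω (Real.exp (t : ℝ)))))) := by
    intro s t
    set u : ℝ := max (s : ℝ) t with hu
    have hu0 : 0 ≤ u := le_max_of_le_left s.2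
    have hl : 0 ≤ Real.log 2 := Real.log_nonneg (by norm_num)
    have h1 := expWeight_le ω (c + d) m (a + b) ⟨u + Real.log 2, by positivity⟩
    have h2 : (2 : ℝ≥0∞) ^ (a + b) = ENNReal.ofReal (Real.exp ((a + b : ℕ) * Real.log 2)) := by
      rw [mul_comm, Real.exp_mul, Real.exp_log (by norm_num), Real.rpow_natCast,
        ENNReal.ofReal_pow (by norm_num)]
      norm_num
    rw [h2]
    refine (mul_le_mul_right h1 _).trans ?_
    rw [← ENNReal.ofReal_mul (by positivity), ← ENNReal.ofReal_mul (by positivity),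
      ← ENNReal.ofReal_mul (by positivity), ← Real.exp_add, ← Real.exp_add, ← Real.exp_add]
    refine ENNReal.ofReal_le_ofReal (Real.exp_le_exp.2 ?_)
    have h3 : Real.exp (u + Real.log 2) = 2 * Real.exp u := by
      rw [Real.exp_add, Real.exp_log (by norm_num), mul_comm]
    have h4 : ω (Real.exp u) ≤ ω (Real.exp s) + ω (Real.exp t) := by
      have hs := hω.nonneg (Real.exp s) (by positivity)
      have ht := hω.nonneg (Real.exp t) (by positivity)
      rcases max_choice (s : ℝ) (t : ℝ) with h | h <;> rw [hu, h] <;> linarith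
    have h5 : m * ω (2 * Real.exp u) ≤ M * (1 + (ω (Real.exp s) + ω (Real.exp t))) := by
      have h6 : 0 ≤ ω (Real.exp u) := hω.nonneg _ (by positivity)
      calc m * ω (2 * Real.exp u) ≤ m * (K * (1 + ω (Real.exp u))) := by
            gcongr; exact hα _ (by positivity)
        _ = m * K * (1 + ω (Real.exp u)) := by ring
        _ ≤ _ := by gcongr
    have h7 : (a : ℝ) * s ≤ a * u := by gcongr; exact le_max_left _ _
    have h8 : (b : ℝ) * t ≤ b * u := by gcongr; exact le_max_right _ _
    have h9 : (((a + b : ℕ) : ℝ)) = a + b := by push_cast; rfl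
    change (a + b : ℕ) * Real.log 2 + (c + d - ((a + b : ℕ) * (u + Real.log 2) -
      m * ω (Real.exp (u + Real.log 2)))) ≤ _
    rw [h3, h9]
    nlinarith
  have hE : ((Real.exp M).toNNReal : ℝ≥0∞) = ENNReal.ofReal (Real.exp M) := rfl
  rw [expWeight_eq_iInf ω c m' a, ENNReal.iInf_mul' (by simp [expWeight_ne_top])
    (fun _ => ⟨0⟩), ENNReal.mul_iInf_of_ne (by simp [Real.exp_pos]) (by simp)]
  refine le_iInf fun s => ?_
  rw [expWeight_eq_iInf ω d m' b, ENNReal.mul_iInf_of_ne (by simp [Real.exp_pos]) (by simp),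
    ENNReal.mul_iInf_of_ne (by simp [Real.exp_pos]) (by simp)]
  exact le_iInf fun t => key s t

/-! ### The Leibniz rule -/

theorem partialDeriv_mul (i : Fin N) {f g : E N → ℂ} (hf : ContDiff ℝ (⊤ : ℕ∞) f)
    (hg : ContDiff ℝ (⊤ : ℕ∞) g) :
    partialDeriv i (f * g) = partialDeriv i f * g + f * partialDeriv i g := by
  funext x
  have h1 : DifferentiableAt ℝ f x := hf.differentiable (by simp) x
  have h2 : DifferentiableAt ℝ g x := hg.differentiable (by simp) x
  simp [partialDeriv, fderiv_mul h1 h2]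
  ring

theorem iter_zero (i : Fin N) (k : ℕ) : (partialDeriv i)^[k] (0 : E N → ℂ) = 0 := by
  have h := iter_smul i k 0 (f := (0 : E N → ℂ)) contDiff_const
  simpa using h

theorem iter_sum (i : Fin N) (k : ℕ) {ι : Type*} (s : Finset ι) {F : ι → E N → ℂ}
    (hF : ∀ p, ContDiff ℝ (⊤ : ℕ∞) (F p)) :
    (partialDeriv i)^[k] (∑ p ∈ s, F p) = ∑ p ∈ s, (partialDeriv i)^[k] (F p) := by
  classical
  induction s using Finset.induction_on with
  | empty => simpa using iter_zero i k
  | insert p s hp ih =>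
    have hs : ContDiff ℝ (⊤ : ℕ∞) (∑ p ∈ s, F p) := by
      have := ContDiff.sum (s := s) (fun p _ => hF p)
      convert this using 1
      funext x; simp
    rw [Finset.sum_insert hp, Finset.sum_insert hp, iter_add i k (hF p) hs, ih]

theorem iter_mul (i : Fin N) (k : ℕ) {f g : E N → ℂ} (hf : ContDiff ℝ (⊤ : ℕ∞) f)
    (hg : ContDiff ℝ (⊤ : ℕ∞) g) :
    (partialDeriv i)^[k] (f * g) = ∑ j ∈ Finset.range (k + 1),
      (k.choose j : ℂ) • ((partialDeriv i)^[j] f * (partialDeriv i)^[k - j] g) := by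
  induction k with
  | zero => simp
  | succ k ih =>
    have hs : ∀ j l, ContDiff ℝ (⊤ : ℕ∞) ((partialDeriv i)^[j] f * (partialDeriv i)^[l] g) :=
      fun j l => (iter_smooth i j hf).mul (iter_smooth i l hg)
    rw [Function.iterate_succ_apply', ih]
    have h1 := iter_sum i 1 (Finset.range (k + 1)) (F := fun j =>
      (k.choose j : ℂ) • ((partialDeriv i)^[j] f * (partialDeriv i)^[k - j] g))
      (fun j => contDiff_const.smul (hs j _))
    rw [Function.iterate_one] at h1
    rw [h1]
    simp only [partialDeriv_smul i _ (hs _ _),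
      partialDeriv_mul i (iter_smooth i _ hf) (iter_smooth i _ hg), smul_add,
      ← Function.iterate_succ_apply', Finset.sum_add_distrib]
    funext x
    have h2 := Finset.sum_choose_succ_mul (R := ℂ)
      (fun a b => (partialDeriv i)^[a] f x * (partialDeriv i)^[b] g x) k
    simp only [Finset.sum_apply, Pi.add_apply, Pi.smul_apply, Pi.mul_apply, smul_eq_mul]
    rw [h2, add_comm]
    congr 1
    refine Finset.sum_congr rfl fun j hj => ?_
    rw [Nat.succ_sub (Nat.lt_succ_iff.1 (Finset.mem_range.1 hj))]

theorem foldr_congr {α β : Fin N → ℕ} {L : List (Fin N)} (h : ∀ i ∈ L, α i = β i) (f : E N → ℂ) :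
    L.foldr (fun i g => (partialDeriv i)^[α i] g) f =
      L.foldr (fun i g => (partialDeriv i)^[β i] g) f := by
  induction L with
  | nil => rfl
  | cons i L ih =>
    simp only [List.foldr_cons]
    rw [ih fun j hj => h j (List.mem_cons_of_mem _ hj), h i List.mem_cons_self]

/-- The Leibniz rule for `∂^α`, recording only that the coefficients are natural numbers with sum
`2^|α|` and that the orders of the two factors add up to `|α|`. The list `L` of coordinates is the
induction variable. -/
theorem exists_foldr_mul_eq (α : Fin N → ℕ) {L : List (Fin N)} (hL : L.Nodup) :
    ∃ (ι : Type) (s : Finset ι) (c : ι → ℕ) (β γ : ι → Fin N → ℕ),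
      ∑ p ∈ s, c p = 2 ^ (L.map α).sum ∧
      (∀ p ∈ s, (L.map (β p)).sum + (L.map (γ p)).sum = (L.map α).sum) ∧
      ∀ f g : E N → ℂ, ContDiff ℝ (⊤ : ℕ∞) f → ContDiff ℝ (⊤ : ℕ∞) g →
        L.foldr (fun i u => (partialDeriv i)^[α i] u) (f * g) = ∑ p ∈ s, (c p : ℂ) •
          (L.foldr (fun i u => (partialDeriv i)^[β p i] u) f *
            L.foldr (fun i u => (partialDeriv i)^[γ p i] u) g) := by
  induction L with
  | nil => exact ⟨Unit, {()}, fun _ => 1, fun _ => 0, fun _ => 0, by simp, by simp, by simp⟩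
  | cons i L ih =>
    obtain ⟨hi, hL'⟩ := List.nodup_cons.1 hL
    obtain ⟨ι, s, c, β, γ, h1, h2, h3⟩ := ih hL'
    have hne : ∀ j ∈ L, j ≠ i := fun j hj h => hi (h ▸ hj)
    have hmap : ∀ (δ : Fin N → ℕ) (v : ℕ), L.map (Function.update δ i v) = L.map δ := fun δ v =>
      List.map_congr_left fun j hj => Function.update_of_ne (hne j hj) _ _
    refine ⟨ι × ℕ, s ×ˢ Finset.range (α i + 1), fun p => c p.1 * (α i).choose p.2,
      fun p => Function.update (β p.1) i p.2, fun p => Function.update (γ p.1) i (α i - p.2),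
      ?_, ?_, ?_⟩
    · rw [Finset.sum_product]
      simp only [← Finset.mul_sum, Nat.sum_range_choose, ← Finset.sum_mul, h1]
      simp [pow_add, mul_comm]
    · rintro ⟨p, j⟩ hp
      obtain ⟨hp1, hp2⟩ := Finset.mem_product.1 hp
      have h4 := h2 p hp1
      have h5 := Finset.mem_range.1 hp2
      simp only [List.map_cons, List.sum_cons, hmap, Function.update_self]
      simp only at h5
      omega
    · intro f g hf hg
      have hs : ∀ p, ContDiff ℝ (⊤ : ℕ∞) (L.foldr (fun i u => (partialDeriv i)^[β p i] u) f *
            L.foldr (fun i u => (partialDeriv i)^[γ p i] u) g) :=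
        fun p => (foldr_smooth _ L hf).mul (foldr_smooth _ L hg)
      have hs' : ∀ p, ContDiff ℝ (⊤ : ℕ∞) ((c p : ℂ) •
          (L.foldr (fun i u => (partialDeriv i)^[β p i] u) f *
            L.foldr (fun i u => (partialDeriv i)^[γ p i] u) g)) :=
        fun p => contDiff_const.smul (hs p)
      rw [List.foldr_cons, h3 f g hf hg, iter_sum i _ s hs', Finset.sum_product]
      refine Finset.sum_congr rfl fun p _ => ?_
      rw [iter_smul i _ _ (hs p), iter_mul i _ (foldr_smooth _ L hf) (foldr_smooth _ L hg),
        Finset.smul_sum]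
      refine Finset.sum_congr rfl fun j _ => ?_
      simp only [List.foldr_cons, Function.update_self]
      rw [foldr_congr (α := Function.update (β p) i j) (β := β p)
          (fun k hk => Function.update_of_ne (hne k hk) _ _),
        foldr_congr (α := Function.update (γ p) i (α i - j)) (β := γ p)
          (fun k hk => Function.update_of_ne (hne k hk) _ _), smul_smul]
      push_cast
      rfl

theorem exists_multiDeriv_mul_eq (α : Fin N → ℕ) :
    ∃ (ι : Type) (s : Finset ι) (c : ι → ℕ) (β γ : ι → Fin N → ℕ),
      ∑ p ∈ s, c p = 2 ^ len α ∧ (∀ p ∈ s, len (β p) + len (γ p) = len α) ∧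
      ∀ f g : E N → ℂ, ContDiff ℝ (⊤ : ℕ∞) f → ContDiff ℝ (⊤ : ℕ∞) g →
        multiDeriv α (f * g) =
          ∑ p ∈ s, (c p : ℂ) • (multiDeriv (β p) f * multiDeriv (γ p) g) := by
  have hlen : ∀ δ : Fin N → ℕ, ((List.finRange N).map δ).sum = len δ := fun δ => by
    rw [len, ← List.ofFn_eq_map, List.sum_ofFn]
  have h := exists_foldr_mul_eq α (List.nodup_finRange N)
  simp only [hlen] at h
  exact h

/-- A weighted form of the Leibniz rule at a point: if the weights absorb `2^(a+b)`, then weighted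
bounds on the derivatives of two factors multiply. -/
theorem enorm_multiDeriv_mul_le {W W₁ W₂ : ℕ → ℝ≥0∞} {C : ℝ≥0∞}
    (hW : ∀ a b, 2 ^ (a + b) * W (a + b) ≤ C * (W₁ a * W₂ b)) {f g : E N → ℂ}
    (hf : ContDiff ℝ (⊤ : ℕ∞) f) (hg : ContDiff ℝ (⊤ : ℕ∞) g) {x : E N} {R S : ℝ≥0∞}
    (hR : ∀ β, ‖multiDeriv β f x‖ₑ * W₁ (len β) ≤ R)
    (hS : ∀ γ, ‖multiDeriv γ g x‖ₑ * W₂ (len γ) ≤ S) (α : Fin N → ℕ) :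
    ‖multiDeriv α (f * g) x‖ₑ * W (len α) ≤ C * (R * S) := by
  obtain ⟨ι, s, c, β, γ, h1, h2, h3⟩ := exists_multiDeriv_mul_eq α
  have h0 : (2 : ℝ≥0∞) ^ len α ≠ 0 := by simp
  have ht : (2 : ℝ≥0∞) ^ len α ≠ ∞ := by simp
  rw [← ENNReal.mul_le_mul_iff_right h0 ht]
  have h4 : ‖multiDeriv α (f * g) x‖ₑ ≤
      ∑ p ∈ s, (c p : ℝ≥0∞) * (‖multiDeriv (β p) f x‖ₑ * ‖multiDeriv (γ p) g x‖ₑ) := by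
    rw [h3 f g hf hg, Finset.sum_apply]
    refine (enorm_sum_le _ _).trans (Finset.sum_le_sum fun p _ => ?_)
    rw [Pi.smul_apply, enorm_smul, Pi.mul_apply, enorm_mul]
    gcongr
    simp [← ofReal_norm]
  calc 2 ^ len α * (‖multiDeriv α (f * g) x‖ₑ * W (len α))
      ≤ 2 ^ len α * ((∑ p ∈ s, (c p : ℝ≥0∞) *
          (‖multiDeriv (β p) f x‖ₑ * ‖multiDeriv (γ p) g x‖ₑ)) * W (len α)) := by gcongr
    _ = ∑ p ∈ s, (c p : ℝ≥0∞) * ((‖multiDeriv (β p) f x‖ₑ * ‖multiDeriv (γ p) g x‖ₑ) *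
          (2 ^ len α * W (len α))) := by
        rw [Finset.sum_mul, Finset.mul_sum]
        exact Finset.sum_congr rfl fun p _ => by ring
    _ ≤ ∑ p ∈ s, (c p : ℝ≥0∞) * (C * (R * S)) := by
        refine Finset.sum_le_sum fun p hp => mul_le_mul_right ?_ _
        rw [← h2 p hp]
        calc _ ≤ (‖multiDeriv (β p) f x‖ₑ * ‖multiDeriv (γ p) g x‖ₑ) *
                (C * (W₁ (len (β p)) * W₂ (len (γ p)))) := mul_le_mul_right (hW _ _) _
          _ = C * ((‖multiDeriv (β p) f x‖ₑ * W₁ (len (β p))) *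
                (‖multiDeriv (γ p) g x‖ₑ * W₂ (len (γ p)))) := by ring
          _ ≤ _ := by gcongr; exacts [hR _, hS _]
    _ = 2 ^ len α * (C * (R * S)) := by
        rw [← Finset.sum_mul, ← Nat.cast_sum, h1]; push_cast; rfl

theorem le_r (ω : ℝ → ℝ) (m n : ℕ+) (f : E N → ℂ) (α : Fin N → ℕ) (x : E N) :
    ‖multiDeriv α f x‖ₑ * expWeight ω (-((n : ℝ) * ω ‖x‖)) m (len α) ≤ r ω m n f :=
  le_iSup₂ (f := fun (α : Fin N → ℕ) (x : E N) => ‖multiDeriv α f x‖ₑ *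
    expWeight ω (-((n : ℝ) * ω ‖x‖)) m (len α)) α x

theorem le_q (ω : ℝ → ℝ) (m : ℕ+) (k f : E N → ℂ) (α : Fin N → ℕ) (x : E N) :
    ‖k x‖ₑ * ‖multiDeriv α f x‖ₑ * expWeight ω 0 m (len α) ≤ q ω m k f :=
  le_iSup₂ (f := fun (α : Fin N → ℕ) (x : E N) =>
    ‖k x‖ₑ * ‖multiDeriv α f x‖ₑ * expWeight ω 0 m (len α)) α x

/-- Multiplication maps `O^{m'}_i × O^{m'}_j` into `O^m_{i+j}`, with a constant independent of
`i` and `j`. -/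
theorem exists_r_mul_le {ω : ℝ → ℝ} (hω : IsNonquasianalyticWeight ω) (m : ℕ+) :
    ∃ (m' : ℕ+) (C : ℝ≥0), ∀ (i j : ℕ+) (f g : E N → ℂ), ContDiff ℝ (⊤ : ℕ∞) f →
      ContDiff ℝ (⊤ : ℕ∞) g → r ω m (i + j) (f * g) ≤ C * (r ω m' i f * r ω m' j g) := by
  obtain ⟨m', C, h⟩ := exists_two_pow_mul_expWeight_le hω m
  refine ⟨m', C, fun i j f g hf hg => iSup₂_le fun α x => ?_⟩
  have e : -(((i + j : ℕ+) : ℝ) * ω ‖x‖) = -((i : ℝ) * ω ‖x‖) + -((j : ℝ) * ω ‖x‖) := by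
    push_cast; ring
  rw [e]
  exact enorm_multiDeriv_mul_le (W := expWeight ω (-((i : ℝ) * ω ‖x‖) + -((j : ℝ) * ω ‖x‖)) m)
    (fun a b => h _ _ a b) hf hg (fun β => le_r ω m' i f β x) (fun γ => le_r ω m' j g γ x) α

theorem exists_q_mul_le {ω : ℝ → ℝ} (hω : IsNonquasianalyticWeight ω) (m : ℕ+) :
    ∃ (m' : ℕ+) (C : ℝ≥0), ∀ (k : E N → ℂ) (l : E N → ℝ), (∀ x, ‖k x‖ ≤ l x ^ 2) →
      ∀ f g : E N → ℂ, ContDiff ℝ (⊤ : ℕ∞) f → ContDiff ℝ (⊤ : ℕ∞) g →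
        q ω m k (f * g) ≤
          C * q ω m' (fun x => (l x : ℂ)) f * q ω m' (fun x => (l x : ℂ)) g := by
  obtain ⟨m', C, h⟩ := exists_two_pow_mul_expWeight_le hω m
  refine ⟨m', C, fun k l hkl f g hf hg => iSup₂_le fun α x => ?_⟩
  set a : ℝ≥0∞ := ‖(l x : ℂ)‖ₑ with ha
  have hk : ‖k x‖ₑ ≤ a * a := by
    rw [ha, ← enorm_mul, ← ofReal_norm, ← ofReal_norm]
    refine ENNReal.ofReal_le_ofReal ((hkl x).trans (le_of_eq ?_))
    rw [← pow_two, norm_pow, Complex.norm_real, Real.norm_eq_abs, sq_abs]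
  have h' := enorm_multiDeriv_mul_le (W := fun n => a * a * expWeight ω (0 + 0) m n)
    (W₁ := fun n => a * expWeight ω 0 m' n) (W₂ := fun n => a * expWeight ω 0 m' n) (C := C)
    (fun i j => by
      calc _ = a * a * (2 ^ (i + j) * expWeight ω (0 + 0) m (i + j)) := by ring
        _ ≤ a * a * (C * (expWeight ω 0 m' i * expWeight ω 0 m' j)) :=
            mul_le_mul_right (h 0 0 i j) _
        _ = _ := by ring) hf hg (x := x)
    (fun β => by
      have := le_q ω m' (fun x => (l x : ℂ)) f β x
      rwa [mul_comm a, ← mul_assoc, mul_right_comm, mul_comm ‖multiDeriv β f x‖ₑ])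
    (fun β => by
      have := le_q ω m' (fun x => (l x : ℂ)) g β x
      rwa [mul_comm a, ← mul_assoc, mul_right_comm, mul_comm ‖multiDeriv β g x‖ₑ]) α
  rw [add_zero] at h'
  calc _ ≤ a * a * ‖multiDeriv α (f * g) x‖ₑ * expWeight ω 0 m (len α) := by gcongr
    _ = ‖multiDeriv α (f * g) x‖ₑ * (a * a * expWeight ω 0 m (len α)) := by ring
    _ ≤ _ := h'
    _ = _ := by ring

/-! ### The inductive limit topology on `O^m_ω` -/

instance (ω : ℝ → ℝ) (m n : ℕ+) : NormedSpace ℂ (StepSpace N ω m n) where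
  norm_smul_le c f := (map_smul_eq_mul (stepNorm N ω m n) c f).le

theorem StepSpace.norm_eq {ω : ℝ → ℝ} {m n : ℕ+} (f : StepSpace N ω m n) :
    ‖f‖ = (r ω m n f.1).toReal := rfl

instance (ω : ℝ → ℝ) (m : ℕ+) : IsScalarTower ℝ ℂ (IndSpace N ω m) :=
  inferInstanceAs (IsScalarTower ℝ ℂ ↥(indSubmodule N ω m))

instance (ω : ℝ → ℝ) (m : ℕ+) : IsTopologicalAddGroup (IndSpace N ω m) :=
  topologicalAddGroup_sInf fun _ ht => ht.1

instance (ω : ℝ → ℝ) (m : ℕ+) : ContinuousSMul ℂ (IndSpace N ω m) :=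
  continuousSMul_sInf fun _ ht => ht.2.1

instance (ω : ℝ → ℝ) (m : ℕ+) : ContinuousSMul ℝ (IndSpace N ω m) :=
  IsScalarTower.continuousSMul ℂ

instance (ω : ℝ → ℝ) (m : ℕ+) : LocallyConvexSpace ℝ (IndSpace N ω m) :=
  LocallyConvexSpace.sInf fun _ ht => ht.2.2.1

open scoped ComplexOrder in
instance (ω : ℝ → ℝ) (m : ℕ+) : LocallyConvexSpace ℂ (IndSpace N ω m) :=
  (locallyConvexSpace_iff_exists_convex_subset_zero ℂ _).2 fun U hU => by
    obtain ⟨S, hS, hc, hSU⟩ :=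
      (locallyConvexSpace_iff_exists_convex_subset_zero ℝ (IndSpace N ω m)).1 inferInstance U hU
    exact ⟨S, hS, convex_of_nonneg_surjective_algebraMap _
      (fun z hz => by
      obtain ⟨h1, h2⟩ := Complex.nonneg_iff.1 hz
      exact ⟨z.re, h1, Complex.ext rfl h2⟩) hc, hSU⟩

theorem continuous_stepIncl (ω : ℝ → ℝ) (m n : ℕ+) : Continuous (stepIncl N ω m n) :=
  continuous_sInf_rng.2 fun _ ht => ht.2.2.2 n

/-- `stepIncl` as a linear map. -/
def stepInclLin (N : ℕ) (ω : ℝ → ℝ) (m n : ℕ+) : StepSpace N ω m n →ₗ[ℂ] IndSpace N ω m where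
  toFun := stepIncl N ω m n
  map_add' _ _ := rfl
  map_smul' _ _ := rfl

/-- `omIncl` as a linear map. -/
def omInclLin (N : ℕ) (ω : ℝ → ℝ) (m : ℕ+) : OM N ω →ₗ[ℂ] IndSpace N ω m where
  toFun := omIncl N ω m
  map_add' _ _ := rfl
  map_smul' _ _ := rfl

theorem exists_stepIncl_eq {ω : ℝ → ℝ} (hω : ∀ t, 0 ≤ t → 0 ≤ ω t) {m : ℕ+} (f : IndSpace N ω m) :
    ∃ (n : ℕ+) (u : StepSpace N ω m n), stepIncl N ω m n u = f := by
  obtain ⟨n, hn⟩ := (mem_indSubmodule hω).1 f.2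
  exact ⟨n, ⟨f.1, hn⟩, rfl⟩

theorem IndSpace.contDiff {ω : ℝ → ℝ} (hω : ∀ t, 0 ≤ t → 0 ≤ ω t) {m : ℕ+} (f : IndSpace N ω m) :
    ContDiff ℝ (⊤ : ℕ∞) f.1 := by
  obtain ⟨n, u, rfl⟩ := exists_stepIncl_eq hω f
  exact u.2.1

/-- A seminorm on `O^m_ω` is continuous as soon as it is bounded on each step. -/
theorem continuous_of_le_norm {ω : ℝ → ℝ} {m : ℕ+} (p : Seminorm ℂ (IndSpace N ω m)) {c : ℕ+ → ℝ}
    (h : ∀ n (u : StepSpace N ω m n), p (stepIncl N ω m n u) ≤ c n * ‖u‖) : Continuous p := by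
  let P : SeminormFamily ℂ (IndSpace N ω m) Unit := fun _ => p
  let t : TopologicalSpace (IndSpace N ω m) := P.moduleFilterBasis.topology
  have hP : @WithSeminorms ℂ (IndSpace N ω m) Unit _ _ _ P t := @WithSeminorms.mk _ _ _ _ _ _ _ t rfl
  have ht : ∀ n : ℕ+, @Continuous _ _ inferInstance t (stepIncl N ω m n) := by
    intro n
    refine (@continuous_iff_continuousAt _ _ _ t _).2 fun u₀ => ?_
    refine (@WithSeminorms.tendsto_nhds ℂ _ _ _ _ _ _ t P hP _ _ _).2 fun _ ε hε => ?_
    have h1 : Filter.Tendsto (fun u : StepSpace N ω m n => c n * ‖u - u₀‖) (nhds u₀)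
        (nhds (c n * ‖u₀ - u₀‖)) :=
      (continuous_const.mul (continuous_id.sub continuous_const).norm).tendsto u₀
    rw [sub_self, norm_zero, mul_zero] at h1
    filter_upwards [h1.eventually (gt_mem_nhds hε)] with u hu
    exact (h n (u - u₀)).trans_lt hu
  have hle : (instTopologicalSpaceIndSpace ω m : TopologicalSpace (IndSpace N ω m)) ≤ t :=
    sInf_le ⟨@WithSeminorms.topologicalAddGroup _ _ _ _ _ _ t _ hP,
      @WithSeminorms.continuousSMul _ _ _ _ _ _ t _ hP,
      @WithSeminorms.toLocallyConvexSpace _ _ _ _ _ _ _ _ _ t _ hP, ht⟩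
  exact continuous_le_dom hle (@WithSeminorms.continuous_seminorm _ _ _ _ _ _ t _ hP ())

theorem exists_le_norm_of_continuous {ω : ℝ → ℝ} {m : ℕ+} (p : Seminorm ℂ (IndSpace N ω m))
    (hp : Continuous p) : ∃ c : ℕ+ → ℝ, (∀ n, 0 ≤ c n) ∧
      ∀ n (u : StepSpace N ω m n), p (stepIncl N ω m n u) ≤ c n * ‖u‖ := by
  have h : ∀ n : ℕ+, ∃ C, 0 < C ∧ ∀ u : StepSpace N ω m n, p (stepIncl N ω m n u) ≤ C * ‖u‖ :=
    fun n => Seminorm.bound_of_continuous_normedSpace (p.comp (stepInclLin N ω m n))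
      (hp.comp (continuous_stepIncl ω m n))
  choose c hc hc' using h
  exact ⟨c, fun n => (hc n).le, hc'⟩

/-- The largest seminorm on `O^m_ω` that is at most `c n` times the norm on the `n`-th step. -/
def maxSeminorm (N : ℕ) (ω : ℝ → ℝ) (m : ℕ+) (c : ℕ+ → ℝ) : Seminorm ℂ (IndSpace N ω m) :=
  sSup {p | ∀ n (u : StepSpace N ω m n), p (stepIncl N ω m n u) ≤ c n * ‖u‖}

theorem bddAbove_seminorms {ω : ℝ → ℝ} (hω : ∀ t, 0 ≤ t → 0 ≤ ω t) (m : ℕ+) (c : ℕ+ → ℝ) :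
    BddAbove {p : Seminorm ℂ (IndSpace N ω m) |
      ∀ n (u : StepSpace N ω m n), p (stepIncl N ω m n u) ≤ c n * ‖u‖} := by
  rw [Seminorm.bddAbove_iff]
  choose n u hu using fun f : IndSpace N ω m => exists_stepIncl_eq hω f
  refine ⟨fun f => c (n f) * ‖u f‖, ?_⟩
  rintro _ ⟨p, hp, rfl⟩ f
  have := hp (n f) (u f)
  rwa [hu f] at this

theorem maxSeminorm_le {ω : ℝ → ℝ} (hω : ∀ t, 0 ≤ t → 0 ≤ ω t) (m : ℕ+) {c : ℕ+ → ℝ}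
    (hc : ∀ n, 0 ≤ c n) (n : ℕ+) (u : StepSpace N ω m n) :
    maxSeminorm N ω m c (stepIncl N ω m n u) ≤ c n * ‖u‖ := by
  rw [maxSeminorm, Seminorm.sSup_apply (bddAbove_seminorms hω m c)]
  exact Real.iSup_le (fun p => p.2 n u) (mul_nonneg (hc n) (norm_nonneg u))

theorem le_maxSeminorm {ω : ℝ → ℝ} (hω : ∀ t, 0 ≤ t → 0 ≤ ω t) (m : ℕ+) {c : ℕ+ → ℝ}
    {p : Seminorm ℂ (IndSpace N ω m)} {K : ℝ} (hK : 0 ≤ K)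
    (h : ∀ n (u : StepSpace N ω m n), p (stepIncl N ω m n u) ≤ K * (c n * ‖u‖))
    (f : IndSpace N ω m) : p f ≤ K * maxSeminorm N ω m c f := by
  rcases hK.eq_or_lt with rfl | hK
  · obtain ⟨n, u, rfl⟩ := exists_stepIncl_eq hω f
    simpa using h n u
  · have h1 : (K⁻¹.toNNReal • p) ≤ maxSeminorm N ω m c := by
      refine le_csSup (bddAbove_seminorms hω m c) fun n u => ?_
      rw [smul_apply, NNReal.smul_def, Real.coe_toNNReal _ (inv_nonneg.2 hK.le),
        smul_eq_mul, inv_mul_le_iff₀ hK]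
      exact h n u
    have h2 := h1 f
    rwa [smul_apply, NNReal.smul_def, Real.coe_toNNReal _ (inv_nonneg.2 hK.le),
        smul_eq_mul, inv_mul_le_iff₀ hK] at h2

theorem continuous_maxSeminorm {ω : ℝ → ℝ} (hω : ∀ t, 0 ≤ t → 0 ≤ ω t) (m : ℕ+) {c : ℕ+ → ℝ}
    (hc : ∀ n, 0 ≤ c n) : Continuous (maxSeminorm N ω m c) :=
  continuous_of_le_norm _ (maxSeminorm_le hω m hc)

/-! ### Continuity of multiplication -/

/-- Multiplication is continuous `O^{m'}_ω × O^{m'}_ω → O^m_ω` for a suitable `m'`, as a bilinear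
map estimate for seminorms. -/
theorem exists_mul_continuous {ω : ℝ → ℝ} (hω : IsNonquasianalyticWeight ω) (m : ℕ+) :
    ∃ (m' : ℕ+) (B : IndSpace N ω m' →ₗ[ℂ] IndSpace N ω m' →ₗ[ℂ] IndSpace N ω m),
      (∀ f g, (B f g).1 = f.1 * g.1) ∧
      ∀ p : Seminorm ℂ (IndSpace N ω m), Continuous p →
        ∃ p' : Seminorm ℂ (IndSpace N ω m'), Continuous p' ∧ ∀ f g, p (B f g) ≤ p' f * p' g := by
  have hn := hω.nonneg
  obtain ⟨m', C, hC⟩ := exists_r_mul_le (N := N) hω m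
  have hmem : ∀ {i j : ℕ+} (u : StepSpace N ω m' i) (v : StepSpace N ω m' j),
      u.1 * v.1 ∈ stepSubmodule N ω m (i + j) := fun {i j} u v =>
    ⟨u.2.1.mul v.2.1, (hC i j _ _ u.2.1 v.2.1).trans_lt
      (ENNReal.mul_lt_top ENNReal.coe_lt_top (ENNReal.mul_lt_top u.2.2 v.2.2))⟩
  have hmem' : ∀ f g : IndSpace N ω m', f.1 * g.1 ∈ indSubmodule N ω m := fun f g => by
    obtain ⟨i, u, rfl⟩ := exists_stepIncl_eq hn f
    obtain ⟨j, v, rfl⟩ := exists_stepIncl_eq hn g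
    exact Submodule.mem_iSup_of_mem (i + j) (hmem u v)
  let B : IndSpace N ω m' →ₗ[ℂ] IndSpace N ω m' →ₗ[ℂ] IndSpace N ω m :=
    LinearMap.mk₂ ℂ (fun f g => ⟨f.1 * g.1, hmem' f g⟩)
      (fun f f' g => Subtype.ext (add_mul f.1 f'.1 g.1))
      (fun c f g => Subtype.ext (smul_mul_assoc c f.1 g.1))
      (fun f g g' => Subtype.ext (mul_add f.1 g.1 g'.1))
      (fun c f g => Subtype.ext (mul_smul_comm c f.1 g.1))
  refine ⟨m', B, fun _ _ => rfl, fun p hp => ?_⟩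
  obtain ⟨c, hc, hcp⟩ := exists_le_norm_of_continuous p hp
  -- the constants `d` satisfy `C * c (i + j) ≤ d i * d j` because `i + j ≤ max i j + max i j`
  let d : ℕ+ → ℝ := fun n => 1 + C * ∑ k ∈ Finset.Icc 1 (n + n), c k
  have hd1 : ∀ n, 1 ≤ d n := fun n =>
    le_add_of_nonneg_right (mul_nonneg C.2 (Finset.sum_nonneg fun k _ => hc k))
  have hd0 : ∀ n, 0 ≤ d n := fun n => zero_le_one.trans (hd1 n)
  have hdc : ∀ n k, k ≤ n + n → C * c k ≤ d n := fun n k hk =>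
    (mul_le_mul_of_nonneg_left (Finset.single_le_sum (f := c) (fun k _ => hc k)
      (Finset.mem_Icc.2 ⟨one_le, hk⟩)) C.2).trans (by simp [d])
  have hd : ∀ i j, C * c (i + j) ≤ d i * d j := by
    intro i j
    rcases le_total i j with h | h
    · exact (hdc j _ (by gcongr)).trans (le_mul_of_one_le_left (hd0 j) (hd1 i))
    · exact (hdc i _ (by gcongr)).trans (le_mul_of_one_le_right (hd0 i) (hd1 j))
  have hB : ∀ i j (u : StepSpace N ω m' i) (v : StepSpace N ω m' j),
      p (B (stepIncl N ω m' i u) (stepIncl N ω m' j v)) ≤ (d i * ‖u‖) * (d j * ‖v‖) := by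
    intro i j u v
    let w : StepSpace N ω m (i + j) := ⟨u.1 * v.1, hmem u v⟩
    have h1 : ‖w‖ ≤ C * (‖u‖ * ‖v‖) := by
      simp only [StepSpace.norm_eq]
      refine (ENNReal.toReal_mono ?_ (hC i j _ _ u.2.1 v.2.1)).trans (le_of_eq ?_)
      · exact ENNReal.mul_ne_top ENNReal.coe_ne_top (ENNReal.mul_ne_top u.2.2.ne v.2.2.ne)
      · rw [ENNReal.toReal_mul, ENNReal.toReal_mul]; rfl
    calc p (B (stepIncl N ω m' i u) (stepIncl N ω m' j v))
        ≤ c (i + j) * ‖w‖ :=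
          hcp (i + j) w
      _ ≤ c (i + j) * (C * (‖u‖ * ‖v‖)) := mul_le_mul_of_nonneg_left h1 (hc _)
      _ = (C * c (i + j)) * (‖u‖ * ‖v‖) := by ring
      _ ≤ (d i * d j) * (‖u‖ * ‖v‖) :=
          mul_le_mul_of_nonneg_right (hd i j) (by positivity)
      _ = _ := by ring
  refine ⟨maxSeminorm N ω m' d, continuous_maxSeminorm hn m' hd0, fun f g => ?_⟩
  -- bound `f ↦ p (f * v)` for `v` in a step, then `g ↦ p (f * g)` for general `f`
  have h1 : ∀ j (v : StepSpace N ω m' j),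
      p (B f (stepIncl N ω m' j v)) ≤ maxSeminorm N ω m' d f * (d j * ‖v‖) := fun j v => by
    rw [mul_comm]
    exact le_maxSeminorm hn m' (p := p.comp (B.flip (stepIncl N ω m' j v)))
      (mul_nonneg (hd0 j) (norm_nonneg v)) (fun i u => by
        rw [mul_comm]; exact hB i j u v) f
  exact le_maxSeminorm hn m' (p := p.comp (B f)) (apply_nonneg _ _) h1 g

/-! ### The space `O_{M,ω}` -/

theorem continuous_omIncl (ω : ℝ → ℝ) (m : ℕ+) : Continuous (omIncl N ω m) :=
  continuous_iInf_dom continuous_induced_dom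

instance (ω : ℝ → ℝ) : IsTopologicalAddGroup (OM N ω) :=
  topologicalAddGroup_iInf fun m => topologicalAddGroup_induced (omInclLin N ω m)

instance (ω : ℝ → ℝ) : ContinuousSMul ℂ (OM N ω) :=
  continuousSMul_iInf fun m => continuousSMul_induced (omInclLin N ω m)

instance (ω : ℝ → ℝ) : LocallyConvexSpace ℝ (OM N ω) :=
  LocallyConvexSpace.iInf fun m =>
    LocallyConvexSpace.induced ((omInclLin N ω m).restrictScalars ℝ)

theorem OM.contDiff {ω : ℝ → ℝ} (hω : ∀ t, 0 ≤ t → 0 ≤ ω t) (f : OM N ω) :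
    ContDiff ℝ (⊤ : ℕ∞) f.1 := (omIncl N ω 1 f).contDiff hω

theorem multiDeriv_zero (f : E N → ℂ) : multiDeriv 0 f = f := by
  simp [multiDeriv]

theorem len_zero : len (0 : Fin N → ℕ) = 0 := by simp [len]

/-- Point evaluations are continuous on each step, hence on `O^m_ω`; this makes `O_{M,ω}`
Hausdorff. -/
theorem continuous_norm_eval {ω : ℝ → ℝ} (hω : ∀ t, 0 ≤ t → 0 ≤ ω t) (m : ℕ+) (x : E N) :
    Continuous fun f : IndSpace N ω m => ‖f.1 x‖ := by
  let p : Seminorm ℂ (IndSpace N ω m) := Seminorm.of (fun f => ‖f.1 x‖)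
    (fun f g => norm_add_le (f.1 x) (g.1 x)) (fun c f => norm_smul c (f.1 x))
  refine continuous_of_le_norm p (c := fun n => Real.exp (n * ω ‖x‖)) fun n u => ?_
  have h1 := le_r ω m n u.1 0 x
  rw [multiDeriv_zero, len_zero] at h1
  have h2 := (mul_le_mul_right (le_expWeight_zero hω (-(n * ω ‖x‖)) m) ‖u.1 x‖ₑ).trans h1
  have h3 := ENNReal.toReal_mono u.2.2.ne h2
  rw [ENNReal.toReal_mul, toReal_enorm, ENNReal.toReal_ofReal (Real.exp_pos _).le, Real.exp_neg,
    mul_inv_le_iff₀ (Real.exp_pos _), mul_comm] at h3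
  exact h3

theorem t2Space_OM {ω : ℝ → ℝ} (hω : ∀ t, 0 ≤ t → 0 ≤ ω t) : T2Space (OM N ω) := by
  refine IsTopologicalAddGroup.t2Space_of_zero_sep fun f hf => ?_
  obtain ⟨x, hx⟩ : ∃ x, f.1 x ≠ 0 := by
    by_contra! h
    exact hf (Subtype.ext (funext h))
  have hc : Continuous fun g : OM N ω => ‖g.1 x‖ :=
    (continuous_norm_eval hω 1 x).comp (continuous_omIncl ω 1)
  refine ⟨{g | ‖g.1 x‖ < ‖f.1 x‖}, (isOpen_lt hc continuous_const).mem_nhds ?_, ?_⟩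
  · change ‖(0 : ℂ)‖ < _
    simpa using hx
  · simp

/-- Pointwise multiplication on `O_{M,ω}`. -/
theorem exists_OM_mul {ω : ℝ → ℝ} (hω : IsNonquasianalyticWeight ω) :
    ∃ mul : OM N ω →ₗ[ℂ] OM N ω →ₗ[ℂ] OM N ω,
      (∀ (f g : OM N ω) (x : E N), mul f g x = f x * g x) ∧
      (∀ f g h : OM N ω, mul (mul f g) h = mul f (mul g h)) ∧
      Continuous (fun p : OM N ω × OM N ω => mul p.1 p.2) := by
  choose m' B hB hp using fun m => exists_mul_continuous (N := N) hω m
  have hmem : ∀ f g : OM N ω, f.1 * g.1 ∈ omSubmodule N ω := fun f g =>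
    (Submodule.mem_iInf _).2 fun m => by
      have := (B m (omIncl N ω (m' m) f) (omIncl N ω (m' m) g)).2
      rwa [hB] at this
  let mul : OM N ω →ₗ[ℂ] OM N ω →ₗ[ℂ] OM N ω :=
    LinearMap.mk₂ ℂ (fun f g => ⟨f.1 * g.1, hmem f g⟩)
      (fun f f' g => Subtype.ext (add_mul f.1 f'.1 g.1))
      (fun c f g => Subtype.ext (smul_mul_assoc c f.1 g.1))
      (fun f g g' => Subtype.ext (mul_add f.1 g.1 g'.1))
      (fun c f g => Subtype.ext (mul_smul_comm c f.1 g.1))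
  refine ⟨mul, fun f g x => rfl, fun f g h => Subtype.ext (mul_assoc f.1 g.1 h.1), ?_⟩
  refine continuous_iInf_rng.2 fun m => continuous_induced_rng.2 ?_
  have hmul : ∀ f g : OM N ω,
      omIncl N ω m (mul f g) = B m (omIncl N ω (m' m) f) (omIncl N ω (m' m) g) :=
    fun f g => Subtype.ext (hB m (omIncl N ω (m' m) f) (omIncl N ω (m' m) g)).symm
  have hws := with_gaugeSeminormFamily (𝕜 := ℂ) (E := IndSpace N ω m)
  refine continuous_iff_continuousAt.2 fun ⟨f₀, g₀⟩ => (hws.tendsto_nhds _ _).2 fun i ε hε => ?_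
  obtain ⟨p', hp', hpB⟩ := hp m _ (hws.continuous_seminorm i)
  have hc : Continuous fun h : OM N ω => p' (omIncl N ω (m' m) h) :=
    hp'.comp (continuous_omIncl ω (m' m))
  have hF : Continuous fun z : OM N ω × OM N ω =>
      p' (omIncl N ω (m' m) (z.1 - f₀)) * p' (omIncl N ω (m' m) (z.2 - g₀)) +
      p' (omIncl N ω (m' m) f₀) * p' (omIncl N ω (m' m) (z.2 - g₀)) +
      p' (omIncl N ω (m' m) (z.1 - f₀)) * p' (omIncl N ω (m' m) g₀) := by
    have h1 := hc.comp (continuous_fst.sub continuous_const :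
      Continuous fun z : OM N ω × OM N ω => z.1 - f₀)
    have h2 := hc.comp (continuous_snd.sub continuous_const :
      Continuous fun z : OM N ω × OM N ω => z.2 - g₀)
    exact ((h1.mul h2).add (continuous_const.mul h2)).add (h1.mul continuous_const)
  have hF0 := hF.tendsto (f₀, g₀)
  have hz : p' (omIncl N ω (m' m) 0) = 0 := map_zero p'
  simp only [sub_self, hz, mul_zero, zero_mul, add_zero] at hF0
  filter_upwards [hF0.eventually (gt_mem_nhds hε)] with z hz
  refine lt_of_le_of_lt ?_ hz
  have hsplit : omIncl N ω m (mul z.1 z.2) - omIncl N ω m (mul f₀ g₀) =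
      omIncl N ω m (mul (z.1 - f₀) (z.2 - g₀)) + omIncl N ω m (mul f₀ (z.2 - g₀)) +
        omIncl N ω m (mul (z.1 - f₀) g₀) := by
    change omInclLin N ω m _ - omInclLin N ω m _ =
      omInclLin N ω m _ + omInclLin N ω m _ + omInclLin N ω m _
    rw [← map_sub, ← map_add, ← map_add]
    congr 1
    simp only [map_sub, LinearMap.sub_apply]
    abel
  change gaugeSeminormFamily ℂ (IndSpace N ω m) i
    (omIncl N ω m (mul z.1 z.2) - omIncl N ω m (mul f₀ g₀)) ≤ _
  rw [hsplit]
  refine (map_add_le_add _ _ _).trans (add_le_add ((map_add_le_add _ _ _).trans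
    (add_le_add ?_ ?_)) ?_) <;> rw [hmul] <;> exact hpB _ _

theorem q_lt_top {ω : ℝ → ℝ} (hω : ∀ t, 0 ≤ t → 0 ≤ ω t) (m : ℕ+) {k : E N → ℂ} (hk : MemS ω k)
    (f : OM N ω) : q ω m k f < ∞ := by
  obtain ⟨n, hf, hr⟩ := (mem_indSubmodule hω).1 (omIncl N ω m f).2
  obtain ⟨C, hC⟩ := hk.decay n (by exact_mod_cast n.pos) 0
  rw [multiDeriv_zero] at hC
  refine lt_of_le_of_lt (iSup₂_le fun α x => ?_)
    (ENNReal.mul_lt_top (a := ENNReal.ofReal C) ENNReal.ofReal_lt_top hr)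
  have h1 := expWeight_eq_mul ω (n * ω ‖x‖) (-((n : ℝ) * ω ‖x‖)) m (len α)
  rw [add_neg_cancel] at h1
  rw [h1]
  calc _ = (ENNReal.ofReal (Real.exp (n * ω ‖x‖)) * ‖k x‖ₑ) *
        (‖multiDeriv α f.1 x‖ₑ * expWeight ω (-((n : ℝ) * ω ‖x‖)) m (len α)) := by ring
    _ ≤ _ := by
        refine mul_le_mul' ?_ (le_r ω m n f.1 α x)
        rw [← ofReal_norm, ← ENNReal.ofReal_mul (Real.exp_pos _).le]
        exact ENNReal.ofReal_le_ofReal (hC x)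

/-! ### Growth of weight functions -/

theorem IsNonquasianalyticWeight.add_le {ω : ℝ → ℝ} (hω : IsNonquasianalyticWeight ω) :
    ∃ K : ℝ, 1 ≤ K ∧ ∀ s t, 0 ≤ s → 0 ≤ t → ω (s + t) ≤ K * (1 + (ω s + ω t)) := by
  obtain ⟨K, hK, h⟩ := hω.alpha
  refine ⟨K, hK, fun s t hs ht => ?_⟩
  have h1 : ω (s + t) ≤ ω (2 * max s t) :=
    hω.monotoneOn (Set.mem_Ici.2 (by positivity)) (Set.mem_Ici.2 (by positivity))
      (by linarith [le_max_left s t, le_max_right s t])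
  have h2 : ω (max s t) ≤ ω s + ω t := by
    have := hω.nonneg s hs
    have := hω.nonneg t ht
    rcases max_choice s t with e | e <;> rw [e] <;> linarith
  calc ω (s + t) ≤ K * (1 + ω (max s t)) := h1.trans (h _ (by positivity))
    _ ≤ _ := by gcongr

/-- A non-quasianalytic weight grows at most linearly: `ω(t)/(5t)` is at most the integral of
`ω(s)/(1+s^2)` over `[t,2t]`. -/
theorem IsNonquasianalyticWeight.le_linear {ω : ℝ → ℝ} (hω : IsNonquasianalyticWeight ω) :
    ∃ C : ℝ, 0 ≤ C ∧ ∀ t, 0 ≤ t → ω t ≤ C * (1 + t) := by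
  set I := ∫ t in Set.Ioi 1, ω t / (1 + t ^ 2) with hI
  have hnn : ∀ t ∈ Set.Ioi (1 : ℝ), 0 ≤ ω t / (1 + t ^ 2) := fun t ht =>
    div_nonneg (hω.nonneg t (zero_le_one.trans (le_of_lt ht))) (by positivity)
  have hI0 : 0 ≤ I := setIntegral_nonneg measurableSet_Ioi hnn
  have h1 : 0 ≤ ω 1 := hω.nonneg 1 zero_le_one
  refine ⟨5 * I + ω 1, by positivity, fun t ht => ?_⟩
  rcases le_total t 1 with h | h
  · have := hω.monotoneOn (Set.mem_Ici.2 ht) (Set.mem_Ici.2 zero_le_one) h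
    nlinarith [mul_nonneg hI0 ht, mul_nonneg h1 ht]
  · have hsub : Set.Ioc t (2 * t) ⊆ Set.Ioi 1 := fun s hs => lt_of_le_of_lt h hs.1
    have h2 : (volume.real (Set.Ioc t (2 * t))) • (ω t / (5 * t ^ 2)) ≤
        ∫ s in Set.Ioc t (2 * t), ω s / (1 + s ^ 2) := by
      refine setIntegral_ge_of_const_le measurableSet_Ioc (by simp) (fun s hs => ?_)
        (hω.beta.mono_set hsub)
      have h3 : ω t ≤ ω s := hω.monotoneOn (Set.mem_Ici.2 ht)
        (Set.mem_Ici.2 (ht.trans hs.1.le)) hs.1.le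
      have h4 : 0 ≤ ω s := (hω.nonneg t ht).trans h3
      have h5 : 1 + s ^ 2 ≤ 5 * t ^ 2 := by nlinarith [hs.1, hs.2]
      gcongr
    have h3 : ∫ s in Set.Ioc t (2 * t), ω s / (1 + s ^ 2) ≤ I :=
      setIntegral_mono_set hω.beta ((ae_restrict_iff' measurableSet_Ioi).2 (.of_forall hnn))
        (LE.le.eventuallyLE hsub)
    have h4 : volume.real (Set.Ioc t (2 * t)) = t := by
      rw [Real.volume_real_Ioc_of_le (by linarith)]; ring
    have h5 := h2.trans h3
    rw [h4, smul_eq_mul] at h5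
    have h6 : t * (ω t / (5 * t ^ 2)) = ω t / (5 * t) := by field_simp
    rw [h6, div_le_iff₀ (by linarith)] at h5
    nlinarith [mul_nonneg h1 ht]

/-- By condition `(γ)`, the functions `e^(λω)` dominate all powers. -/
theorem IsNonquasianalyticWeight.pow_le {ω : ℝ → ℝ} (hω : IsNonquasianalyticWeight ω) (r : ℕ) :
    ∃ lam C : ℝ, 0 < lam ∧ 0 < C ∧ ∀ t, 0 ≤ t → (1 + t) ^ r ≤ C * Real.exp (lam * ω t) := by
  obtain ⟨a, b, hb, h⟩ := hω.gamma
  have hlam : 0 < (r + 1) / b := by positivity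
  refine ⟨(r + 1) / b, Real.exp (-((r + 1) / b * a)), hlam, Real.exp_pos _, fun t ht => ?_⟩
  rw [← Real.exp_add]
  have h1 : (1 + t) ^ r ≤ (1 + t) ^ (r + 1) := pow_le_pow_right₀ (by linarith) (by omega)
  refine h1.trans ?_
  have h2 : (1 + t) ^ (r + 1) = Real.exp ((r + 1) * Real.log (1 + t)) := by
    rw [mul_comm, Real.exp_mul, Real.exp_log (by linarith)]
    exact_mod_cast (Real.rpow_natCast (1 + t) (r + 1)).symm
  rw [h2]
  refine Real.exp_le_exp.2 ?_
  have h3 := mul_le_mul_of_nonneg_left (h t ht) hlam.le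
  have h4 : (r + 1) / b * (a + b * Real.log (1 + t)) =
    (r + 1) / b * a + (r + 1) * Real.log (1 + t) := by field_simp
  linarith

/-! ### Functions decaying faster than all `e^(-λω)` -/

/-- The function `u` is bounded by a multiple of `e^(-λω)` for every `λ > 0`. -/
def Decays (ω : ℝ → ℝ) {F : Type*} [Norm F] (u : E N → F) : Prop :=
  ∀ lam : ℝ, 0 < lam → ∃ C : ℝ, ∀ x, Real.exp (lam * ω ‖x‖) * ‖u x‖ ≤ C

section Decays

variable {F : Type*} [NormedAddCommGroup F] {ω : ℝ → ℝ} {u : E N → F}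

theorem Decays.exists_le (hω : IsNonquasianalyticWeight ω) (hu : Decays ω u) {lam : ℝ}
    (hlam : 0 ≤ lam) (r : ℕ) :
    ∃ C : ℝ, 0 ≤ C ∧ ∀ x, Real.exp (lam * ω ‖x‖) * ‖u x‖ ≤ C * ((1 + ‖x‖) ^ r)⁻¹ := by
  obtain ⟨μ, B, hμ, hB, h1⟩ := hω.pow_le r
  obtain ⟨C, hC⟩ := hu (lam + μ) (by positivity)
  have hC0 : 0 ≤ C := le_trans (by positivity) (hC 0)
  refine ⟨B * C, by positivity, fun x => ?_⟩
  rw [← div_eq_mul_inv, le_div_iff₀ (by positivity)]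
  calc Real.exp (lam * ω ‖x‖) * ‖u x‖ * (1 + ‖x‖) ^ r
      ≤ Real.exp (lam * ω ‖x‖) * ‖u x‖ * (B * Real.exp (μ * ω ‖x‖)) := by
        gcongr; exact h1 _ (norm_nonneg x)
    _ = B * (Real.exp ((lam + μ) * ω ‖x‖) * ‖u x‖) := by
        rw [add_mul, Real.exp_add]; ring
    _ ≤ B * C := by gcongr; exact hC x

theorem integrable_one_add_norm_pow_inv :
    Integrable fun x : E N => ((1 + ‖x‖) ^ (N + 1))⁻¹ := by
  have h := integrable_one_add_norm (E := E N) (μ := volume) (r := (N + 1 : ℕ)) (by simp)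
  refine h.congr (.of_forall fun x => ?_)
  simp only
  rw [Real.rpow_neg (by positivity), Real.rpow_natCast]

theorem Decays.integrable_pow_mul (hω : IsNonquasianalyticWeight ω) (hu : Decays ω u)
    (hm : AEStronglyMeasurable u) (n : ℕ) : Integrable fun x => ‖x‖ ^ n * ‖u x‖ := by
  obtain ⟨C, hC0, hC⟩ := hu.exists_le hω le_rfl (n + (N + 1))
  refine (integrable_one_add_norm_pow_inv.const_mul C).mono'
    ((continuous_norm.pow n).aestronglyMeasurable.mul hm.norm) (.of_forall fun x => ?_)
  have h := hC x
  rw [zero_mul, Real.exp_zero, one_mul] at h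
  rw [Real.norm_of_nonneg (by positivity)]
  have h1 : ‖x‖ ^ n ≤ (1 + ‖x‖) ^ n := by gcongr; linarith
  calc ‖x‖ ^ n * ‖u x‖ ≤ (1 + ‖x‖) ^ n * (C * ((1 + ‖x‖) ^ (n + (N + 1)))⁻¹) := by gcongr
    _ = C * ((1 + ‖x‖) ^ (N + 1))⁻¹ := by rw [pow_add]; field_simp

theorem Decays.integrable (hω : IsNonquasianalyticWeight ω) (hu : Decays ω u)
    (hm : AEStronglyMeasurable u) : Integrable u := by
  refine (integrable_norm_iff hm).1 ?_
  simpa using hu.integrable_pow_mul hω hm 0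

end Decays

/-- Smooth functions all of whose derivatives are bounded. -/
def BoundedDerivs (u : E N → ℂ) : Prop :=
  ContDiff ℝ (⊤ : ℕ∞) u ∧ ∀ n : ℕ, ∃ C : ℝ, ∀ x, ‖iteratedFDeriv ℝ n u x‖ ≤ C

theorem Decays.boundedDerivs_fourier {ω : ℝ → ℝ} (hω : IsNonquasianalyticWeight ω) {u : E N → ℂ}
    (hu : Decays ω u) (hm : AEStronglyMeasurable u) : BoundedDerivs (𝓕 u) := by
  have hi : ∀ n : ℕ, (n : ℕ∞) ≤ (⊤ : ℕ∞) → Integrable fun x => ‖x‖ ^ n * ‖u x‖ := fun n _ =>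
    hu.integrable_pow_mul hω hm n
  refine ⟨Real.contDiff_fourier hi, fun n =>
    ⟨∫ v, ‖VectorFourier.fourierPowSMulRight (innerSL ℝ) u v n‖, fun x => ?_⟩⟩
  rw [Real.iteratedFDeriv_fourier hi hm le_top]
  exact VectorFourier.norm_fourierIntegral_le_integral_norm _ _ _ _ x

theorem BoundedDerivs.partialDeriv {u : E N → ℂ} (hu : BoundedDerivs u) (i : Fin N) :
    BoundedDerivs (partialDeriv i u) := by
  refine ⟨partialDeriv_smooth i hu.1, fun n => ?_⟩
  obtain ⟨C, hC⟩ := hu.2 (n + 1)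
  let L : (E N →L[ℝ] ℂ) →L[ℝ] ℂ := ContinuousLinearMap.apply ℝ ℂ (EuclideanSpace.single i (1 : ℝ))
  refine ⟨‖L‖ * C, fun x => ?_⟩
  have h : ContDiff ℝ (⊤ : ℕ∞) (fderiv ℝ u) := hu.1.fderiv_right (by simp)
  refine (L.norm_iteratedFDeriv_comp_left (f := fderiv ℝ u) (n := n) h.contDiffAt
    (by exact_mod_cast le_top)).trans ?_
  rw [norm_iteratedFDeriv_fderiv]
  gcongr
  exact hC x

/-- The Landau–Kolmogorov argument: a first-order Taylor expansion with step `t = e^(-λω(x))`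
transfers the decay of `u` to its first derivatives, if the second derivatives are bounded. -/
theorem Decays.partialDeriv {ω : ℝ → ℝ} (hω : IsNonquasianalyticWeight ω) {u : E N → ℂ}
    (hu : Decays ω u) (hb : BoundedDerivs u) (i : Fin N) : Decays ω (partialDeriv i u) := by
  obtain ⟨K, hK, hadd⟩ := hω.add_le
  obtain ⟨M, hM⟩ := hb.2 2
  have hM0 : 0 ≤ M := (norm_nonneg _).trans (hM 0)
  intro lam hlam
  have hnn : ∀ x : E N, 0 ≤ ω ‖x‖ := fun x => hω.nonneg _ (norm_nonneg x)
  have h1 : 0 ≤ ω 1 := hω.nonneg 1 zero_le_one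
  obtain ⟨A, hA⟩ := hu (2 * lam * K) (by positivity)
  have hA0 : 0 ≤ A := le_trans (by positivity) (hA 0)
  set B := Real.exp (2 * lam * K * (1 + ω 1)) with hB
  -- decay of `u` at points at distance at most `1` from `x`, in terms of `ω ‖x‖`
  have hnear : ∀ x y : E N, ‖x - y‖ ≤ 1 → Real.exp (2 * lam * ω ‖x‖) * ‖u y‖ ≤ B * A := by
    intro x y hxy
    have h2 : ω ‖x‖ ≤ K * (1 + (ω ‖y‖ + ω 1)) := by
      refine le_trans (hω.monotoneOn (norm_nonneg x) (Set.mem_Ici.2 (by positivity)) ?_)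
        (hadd ‖y‖ 1 (norm_nonneg y) zero_le_one)
      have := norm_add_le y (x - y)
      rw [add_sub_cancel] at this
      linarith
    calc Real.exp (2 * lam * ω ‖x‖) * ‖u y‖
        ≤ Real.exp (2 * lam * K * (1 + ω 1) + 2 * lam * K * ω ‖y‖) * ‖u y‖ := by
          gcongr
          nlinarith [mul_le_mul_of_nonneg_left h2 (by positivity : 0 ≤ 2 * lam)]
      _ = B * (Real.exp (2 * lam * K * ω ‖y‖) * ‖u y‖) := by rw [Real.exp_add]; ring
      _ ≤ B * A := by gcongr; exact hA y
  refine ⟨2 * (B * A) + M, fun x => ?_⟩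
  set t := Real.exp (-(lam * ω ‖x‖)) with ht
  have ht0 : 0 < t := Real.exp_pos _
  have ht1 : t ≤ 1 := Real.exp_le_one_iff.2 (neg_nonpos.2 (mul_nonneg hlam.le (hnn x)))
  set e : E N := EuclideanSpace.single i (1 : ℝ) with he
  have hen : ‖e‖ = 1 := by simp [he]
  have hdu : Differentiable ℝ u := hb.1.differentiable (by simp)
  have hddu : Differentiable ℝ (fderiv ℝ u) :=
    (hb.1.fderiv_right (m := (⊤ : ℕ∞)) (by simp)).differentiable (by simp)
  have hx0 : x ∈ Metric.closedBall x t := Metric.mem_closedBall_self ht0.le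
  have hlip : ∀ y ∈ Metric.closedBall x t, ‖fderiv ℝ u y - fderiv ℝ u x‖ ≤ M * t := by
    intro y hy
    refine ((convex_closedBall x t).norm_image_sub_le_of_norm_fderiv_le (𝕜 := ℝ) (C := M)
      (fun z _ => hddu z) (fun z _ => ?_) hx0 hy).trans ?_
    · rw [← norm_iteratedFDeriv_one, norm_iteratedFDeriv_fderiv]
      exact hM z
    · gcongr
      rwa [← dist_eq_norm, ← Metric.mem_closedBall]
  have hte : ‖t • e‖ = t := by rw [norm_smul, hen, mul_one, Real.norm_of_nonneg ht0.le]
  have hy : x + t • e ∈ Metric.closedBall x t := by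
    rw [Metric.mem_closedBall, dist_eq_norm, add_sub_cancel_left, hte]
  have htaylor := (convex_closedBall x t).norm_image_sub_le_of_norm_fderiv_le' (𝕜 := ℝ)
    (C := M * t) (φ := fderiv ℝ u x) (fun z _ => hdu z) hlip hx0 hy
  rw [add_sub_cancel_left, hte, map_smul] at htaylor
  have hp : UltraMult.partialDeriv i u x = fderiv ℝ u x e := rfl
  have hbound : t * ‖UltraMult.partialDeriv i u x‖ ≤ ‖u (x + t • e)‖ + ‖u x‖ + M * t * t := by
    have h3 : t * ‖UltraMult.partialDeriv i u x‖ = ‖t • fderiv ℝ u x e‖ := by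
      rw [norm_smul, Real.norm_of_nonneg ht0.le, hp]
    rw [h3]
    calc ‖t • fderiv ℝ u x e‖
        = ‖(u (x + t • e) - u x) - (u (x + t • e) - u x - t • fderiv ℝ u x e)‖ := by
          congr 1; abel
      _ ≤ ‖u (x + t • e) - u x‖ + ‖u (x + t • e) - u x - t • fderiv ℝ u x e‖ := norm_sub_le _ _
      _ ≤ _ := add_le_add (norm_sub_le _ _) htaylor
  set w := Real.exp (lam * ω ‖x‖) with hw
  have hwt : w * t = 1 := by rw [hw, ht, ← Real.exp_add, add_neg_cancel, Real.exp_zero]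
  have hww : w * w = Real.exp (2 * lam * ω ‖x‖) := by rw [hw, ← Real.exp_add]; ring_nf
  have h4 := hnear x (x + t • e) (by
    rw [sub_add_cancel_left, norm_neg, hte]; exact ht1)
  have h5 := hnear x x (by simp)
  rw [← hww] at h4 h5
  calc w * ‖UltraMult.partialDeriv i u x‖
      = (w * t) * (w * ‖UltraMult.partialDeriv i u x‖) := by rw [hwt, one_mul]
    _ = w * w * (t * ‖UltraMult.partialDeriv i u x‖) := by ring
    _ ≤ w * w * (‖u (x + t • e)‖ + ‖u x‖ + M * t * t) := by gcongr
    _ = w * w * ‖u (x + t • e)‖ + w * w * ‖u x‖ + M * (w * t) * (w * t) := by ring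
    _ ≤ B * A + B * A + M * 1 * 1 := by rw [hwt]; gcongr
    _ = _ := by ring

theorem Decays.multiDeriv {ω : ℝ → ℝ} (hω : IsNonquasianalyticWeight ω) {u : E N → ℂ}
    (hu : Decays ω u) (hb : BoundedDerivs u) (α : Fin N → ℕ) : Decays ω (multiDeriv α u) := by
  have hiter : ∀ (i : Fin N) (k : ℕ) {v : E N → ℂ}, Decays ω v ∧ BoundedDerivs v →
      Decays ω ((UltraMult.partialDeriv i)^[k] v) ∧
        BoundedDerivs ((UltraMult.partialDeriv i)^[k] v) := by
    intro i k
    induction k with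
    | zero => exact fun h => h
    | succ k ih =>
      intro v hv
      exact ih ⟨hv.1.partialDeriv hω hv.2 i, hv.2.partialDeriv i⟩
  have hfold : ∀ L : List (Fin N),
      Decays ω (L.foldr (fun i g => (UltraMult.partialDeriv i)^[α i] g) u) ∧
        BoundedDerivs (L.foldr (fun i g => (UltraMult.partialDeriv i)^[α i] g) u) := by
    intro L
    induction L with
    | nil => exact ⟨hu, hb⟩
    | cons i L ih => exact hiter i (α i) ih
  exact (hfold _).1

/-- For continuous functions, membership in `S_ω` follows from the decay of the function and of its
Fourier transform alone. -/
theorem memS_of_decays {ω : ℝ → ℝ} (hω : IsNonquasianalyticWeight ω) {u : E N → ℂ}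
    (hc : Continuous u) (hu : Decays ω u) (hf : Decays ω (𝓕 u)) : MemS ω u := by
  have hui := hu.integrable hω hc.aestronglyMeasurable
  have hbf := hu.boundedDerivs_fourier hω hc.aestronglyMeasurable
  have hfi := hf.integrable hω hbf.1.continuous.aestronglyMeasurable
  have hneg : Decays ω fun x => 𝓕 u (-x) := fun lam hlam => by
    obtain ⟨C, hC⟩ := hf lam hlam
    exact ⟨C, fun x => by simpa using hC (-x)⟩
  have hb : BoundedDerivs u := by
    have h := hneg.boundedDerivs_fourier hω
      (hbf.1.continuous.comp continuous_neg).aestronglyMeasurable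
    rwa [← Real.fourierInv_eq_fourier_comp_neg, hc.fourierInv_fourier_eq hui hfi] at h
  exact ⟨hui, hb.1, hbf.1, fun lam hlam α => hu.multiDeriv hω hb α lam hlam,
    fun lam hlam α => hf.multiDeriv hω hbf α lam hlam⟩

/-! ### Regularization by a Gaussian -/

/-- The Gaussian `e^(-π|x|^2)`, which is its own Fourier transform. -/
def gauss (N : ℕ) (x : E N) : ℂ := Complex.exp (-(Real.pi : ℂ) * (‖x‖ : ℂ) ^ 2)

theorem gauss_eq (x : E N) : gauss N x = (Real.exp (-Real.pi * ‖x‖ ^ 2) : ℝ) := by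
  simp [gauss]

theorem norm_gauss (x : E N) : ‖gauss N x‖ = Real.exp (-Real.pi * ‖x‖ ^ 2) := by
  rw [gauss_eq, Complex.norm_real, Real.norm_of_nonneg (Real.exp_pos _).le]

theorem continuous_gauss : Continuous (gauss N) := by
  unfold gauss; fun_prop

theorem fourier_gauss : 𝓕 (gauss N) = gauss N := by
  funext w
  have h := fourier_gaussian_innerProductSpace (V := E N) (b := (Real.pi : ℂ))
    (by simpa using Real.pi_pos) w
  have hpi : (Real.pi : ℂ) ≠ 0 := by exact_mod_cast Real.pi_ne_zero
  change 𝓕 (fun v : E N => Complex.exp (-(Real.pi : ℂ) * (‖v‖ : ℂ) ^ 2)) w = _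
  rw [h, div_self hpi, Complex.one_cpow, one_mul, gauss]
  congr 1
  field_simp

theorem decays_gauss {ω : ℝ → ℝ} (hω : IsNonquasianalyticWeight ω) : Decays ω (gauss N) := by
  obtain ⟨C, hC0, hC⟩ := hω.le_linear
  intro lam hlam
  refine ⟨Real.exp (lam * C + (lam * C) ^ 2), fun x => ?_⟩
  rw [norm_gauss, ← Real.exp_add]
  refine Real.exp_le_exp.2 ?_
  have h1 := mul_le_mul_of_nonneg_left (hC ‖x‖ (norm_nonneg x)) hlam.le
  have h2 : ‖x‖ ^ 2 ≤ Real.pi * ‖x‖ ^ 2 :=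
    le_mul_of_one_le_left (by positivity) (by linarith [Real.pi_gt_three])
  nlinarith [sq_nonneg (lam * C - ‖x‖), sq_nonneg (lam * C), sq_nonneg ‖x‖]

open scoped Convolution in
/-- Convolving a measurable function of rapid decay with a Gaussian gives an element of `S_ω`. -/
theorem memS_convolution_gauss {ω : ℝ → ℝ} (hω : IsNonquasianalyticWeight ω) {h : E N → ℂ}
    (hm : AEStronglyMeasurable h) (hh : Decays ω h) :
    MemS ω fun x => ∫ y, h y * gauss N (x - y) := by
  have hG := decays_gauss (N := N) hω
  have hhi := hh.integrable hω hm
  have hGi := hG.integrable hω continuous_gauss.aestronglyMeasurable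
  have hconv : (fun x => ∫ y, h y * gauss N (x - y)) =
      (h ⋆[ContinuousLinearMap.mul ℂ ℂ] gauss N) := rfl
  rw [hconv]
  refine memS_of_decays hω ?_ ?_ ?_
  · refine BddAbove.continuous_convolution_right_of_integrable _ ?_ hhi continuous_gauss
    refine ⟨1, ?_⟩
    rintro _ ⟨x, rfl⟩
    simp only [norm_gauss]
    exact Real.exp_le_one_iff.2 (by nlinarith [Real.pi_pos, sq_nonneg ‖x‖])
  · obtain ⟨K, hK, hadd⟩ := hω.add_le
    intro lam hlam
    obtain ⟨A, hA⟩ := hG (lam * K) (by positivity)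
    have hA0 : 0 ≤ A := le_trans (by positivity) (hA 0)
    obtain ⟨B, hB0, hB⟩ := hh.exists_le hω (lam := lam * K) (by positivity) (N + 1)
    refine ⟨∫ y : E N, Real.exp (lam * K) * A * B * ((1 + ‖y‖) ^ (N + 1))⁻¹, fun x => ?_⟩
    rw [← Real.norm_of_nonneg (Real.exp_pos (lam * ω ‖x‖)).le, ← norm_smul, ← hconv]
    simp only
    rw [← integral_smul]
    refine norm_integral_le_of_norm_le (integrable_one_add_norm_pow_inv.const_mul _)
      (.of_forall fun y => ?_)
    rw [norm_smul, Real.norm_of_nonneg (Real.exp_pos _).le, norm_mul]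
    have h2 : ω ‖x‖ ≤ K * (1 + (ω ‖y‖ + ω ‖x - y‖)) := by
      refine le_trans (hω.monotoneOn (norm_nonneg x) (Set.mem_Ici.2 (by positivity)) ?_)
        (hadd _ _ (norm_nonneg y) (norm_nonneg (x - y)))
      have := norm_add_le y (x - y)
      rwa [add_sub_cancel] at this
    calc Real.exp (lam * ω ‖x‖) * (‖h y‖ * ‖gauss N (x - y)‖)
        ≤ Real.exp (lam * K + lam * K * ω ‖y‖ + lam * K * ω ‖x - y‖) *
            (‖h y‖ * ‖gauss N (x - y)‖) := by
          gcongr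
          nlinarith [mul_le_mul_of_nonneg_left h2 hlam.le]
      _ = Real.exp (lam * K) * (Real.exp (lam * K * ω ‖x - y‖) * ‖gauss N (x - y)‖) *
            (Real.exp (lam * K * ω ‖y‖) * ‖h y‖) := by
          rw [Real.exp_add, Real.exp_add]; ring
      _ ≤ Real.exp (lam * K) * A * (B * ((1 + ‖y‖) ^ (N + 1))⁻¹) :=
          mul_le_mul (mul_le_mul_of_nonneg_left (hA (x - y)) (Real.exp_pos _).le) (hB y)
            (by positivity) (by positivity)
      _ = _ := by ring
  · intro lam hlam
    obtain ⟨A, hA⟩ := hG lam hlam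
    refine ⟨(∫ y, ‖h y‖) * A, fun ξ => ?_⟩
    rw [Real.fourier_mul_convolution_eq hhi hGi, fourier_gauss, norm_mul, mul_left_comm]
    have h1 : ‖𝓕 h ξ‖ ≤ ∫ y, ‖h y‖ :=
      VectorFourier.norm_fourierIntegral_le_integral_norm _ _ _ _ ξ
    exact mul_le_mul h1 (hA ξ) (by positivity) (integral_nonneg fun y => norm_nonneg _)

/-! ### Square roots of elements of `S_ω` -/

/-- The least radially decreasing majorant of `√|k|`, shifted outwards by `1`. -/
def radialMajorant (k : E N → ℂ) (t : ℝ) : ℝ :=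
  ⨆ z : E N, if t ≤ ‖z‖ + 1 then √‖k z‖ else 0

theorem radialMajorant_nonneg (k : E N → ℂ) (t : ℝ) : 0 ≤ radialMajorant k t :=
  Real.iSup_nonneg fun z => by split_ifs <;> positivity

theorem radialMajorant_bddAbove {k : E N → ℂ} {C : ℝ} (hC : ∀ x, ‖k x‖ ≤ C) (t : ℝ) :
    BddAbove (Set.range fun z : E N => if t ≤ ‖z‖ + 1 then √‖k z‖ else 0) := by
  refine ⟨√C, ?_⟩
  rintro _ ⟨z, rfl⟩
  simp only
  split_ifs
  · exact Real.sqrt_le_sqrt (hC z)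
  · positivity

theorem radialMajorant_antitone {k : E N → ℂ} {C : ℝ} (hC : ∀ x, ‖k x‖ ≤ C) :
    Antitone (radialMajorant k) := by
  intro s t hst
  refine ciSup_mono (radialMajorant_bddAbove hC s) fun z => ?_
  split_ifs with h1 h2
  · exact le_rfl
  · exact absurd (hst.trans h1) h2
  · positivity
  · exact le_rfl

theorem sqrt_le_radialMajorant {k : E N → ℂ} {C : ℝ} (hC : ∀ x, ‖k x‖ ≤ C) {x : E N} {t : ℝ}
    (h : t ≤ ‖x‖ + 1) : √‖k x‖ ≤ radialMajorant k t := by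
  refine le_trans (le_of_eq ?_) (le_ciSup (radialMajorant_bddAbove hC t) x)
  rw [if_pos h]

theorem decays_radialMajorant {ω : ℝ → ℝ} (hω : IsNonquasianalyticWeight ω) {k : E N → ℂ}
    (hk : Decays ω k) : Decays ω fun y : E N => radialMajorant k ‖y‖ := by
  obtain ⟨K, hK, hadd⟩ := hω.add_le
  intro lam hlam
  obtain ⟨A, hA⟩ := hk (2 * (lam * K)) (by positivity)
  refine ⟨Real.exp (lam * K * (1 + ω 1)) * √A, fun y => ?_⟩
  rw [Real.norm_of_nonneg (radialMajorant_nonneg k _), ← le_div_iff₀' (Real.exp_pos _)]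
  refine Real.iSup_le (fun z => ?_) (by positivity)
  split_ifs with h
  · rw [le_div_iff₀' (Real.exp_pos _)]
    have h1 : Real.exp (lam * K * ω ‖z‖) * √‖k z‖ ≤ √A := by
      refine Real.le_sqrt_of_sq_le ?_
      rw [mul_pow, Real.sq_sqrt (norm_nonneg _), ← Real.exp_nat_mul]
      refine le_of_eq_of_le ?_ (hA z)
      push_cast; ring_nf
    have h2 : ω ‖y‖ ≤ K * (1 + (ω ‖z‖ + ω 1)) :=
      (hω.monotoneOn (norm_nonneg y) (Set.mem_Ici.2 (by positivity)) h).trans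
        (hadd _ _ (norm_nonneg z) zero_le_one)
    calc Real.exp (lam * ω ‖y‖) * √‖k z‖
        ≤ Real.exp (lam * K * (1 + ω 1) + lam * K * ω ‖z‖) * √‖k z‖ := by
          gcongr
          nlinarith [mul_le_mul_of_nonneg_left h2 hlam.le]
      _ = Real.exp (lam * K * (1 + ω 1)) * (Real.exp (lam * K * ω ‖z‖) * √‖k z‖) := by
          rw [Real.exp_add]; ring
      _ ≤ _ := by gcongr
  · positivity

/-- Every `k ∈ S_ω` satisfies `|k| ≤ l^2` for a nonnegative `l ∈ S_ω`: take for `l` a multiple of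
the convolution of a radially decreasing majorant of `√|k|` with a Gaussian. -/
theorem exists_norm_le_sq {ω : ℝ → ℝ} (hω : IsNonquasianalyticWeight ω) {k : E N → ℂ}
    (hk : MemS ω k) :
    ∃ l : E N → ℝ, MemS ω (fun x => (l x : ℂ)) ∧ ∀ x, 0 ≤ l x ∧ ‖k x‖ ≤ l x ^ 2 := by
  have hkd : Decays ω k := fun lam hlam => by
    simpa [multiDeriv_zero] using hk.decay lam hlam 0
  obtain ⟨C, hC0, hC⟩ := hkd.exists_le hω le_rfl 0
  simp only [zero_mul, Real.exp_zero, one_mul, pow_zero, inv_one, mul_one] at hC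
  -- the constant makes the Gaussian average over a unit ball at least `1`
  set V : ℝ := volume.real (Metric.closedBall (0 : E N) 1) with hV
  have hVpos : 0 < V := ENNReal.toReal_pos
    (Metric.measure_closedBall_pos volume _ one_pos).ne' measure_closedBall_lt_top.ne
  set c : ℝ := Real.exp Real.pi / V with hc
  have hcpos : 0 < c := by positivity
  let h : E N → ℝ := fun y => c * radialMajorant k ‖y‖
  have hnn : ∀ y, 0 ≤ h y := fun y => mul_nonneg hcpos.le (radialMajorant_nonneg k _)
  have hmeas : Measurable h :=
    ((radialMajorant_antitone hC).measurable.comp measurable_norm).const_mul c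
  have hdec : Decays ω fun y => (h y : ℂ) := fun lam hlam => by
    obtain ⟨A, hA⟩ := decays_radialMajorant hω hkd lam hlam
    refine ⟨c * A, fun y => ?_⟩
    rw [Complex.norm_real, norm_mul, Real.norm_of_nonneg hcpos.le, mul_left_comm]
    gcongr
    exact hA y
  have hcm : AEStronglyMeasurable (fun y => (h y : ℂ)) :=
    (Complex.measurable_ofReal.comp hmeas).aestronglyMeasurable
  have hS := memS_convolution_gauss hω hcm hdec
  let l : E N → ℝ := fun x => ∫ y, h y * Real.exp (-Real.pi * ‖x - y‖ ^ 2)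
  have hl : (fun x => (l x : ℂ)) = fun x => ∫ y, (h y : ℂ) * gauss N (x - y) := by
    funext x
    simp only [l, gauss_eq, ← Complex.ofReal_mul]
    exact integral_ofReal.symm
  have hl0 : ∀ x, 0 ≤ l x := fun x =>
    integral_nonneg fun y => mul_nonneg (hnn y) (Real.exp_pos _).le
  refine ⟨l, hl ▸ hS, fun x => ⟨hl0 x, ?_⟩⟩
  have hi : Integrable h := by
    have := (hdec.integrable hω hcm).re
    simpa using this
  have hint : Integrable fun y => h y * Real.exp (-Real.pi * ‖x - y‖ ^ 2) := by
    refine hi.mono' (hmeas.aestronglyMeasurable.mul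
      (Continuous.aestronglyMeasurable (by fun_prop))) (.of_forall fun y => ?_)
    rw [Real.norm_of_nonneg (mul_nonneg (hnn y) (Real.exp_pos _).le)]
    exact mul_le_of_le_one_right (hnn y)
      (Real.exp_le_one_iff.2 (by nlinarith [Real.pi_pos, sq_nonneg ‖x - y‖]))
  have hlow : √‖k x‖ ≤ l x := by
    have h1 : volume.real (Metric.closedBall x 1) • (c * √‖k x‖ * Real.exp (-Real.pi)) ≤
        ∫ y in Metric.closedBall x 1, h y * Real.exp (-Real.pi * ‖x - y‖ ^ 2) := by
      refine setIntegral_ge_of_const_le measurableSet_closedBall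
        measure_closedBall_lt_top.ne (fun y hy => ?_) hint.integrableOn
      have hxy : ‖x - y‖ ≤ 1 := by
        rw [← dist_eq_norm, dist_comm]; exact Metric.mem_closedBall.1 hy
      have hyx : ‖y‖ ≤ ‖x‖ + 1 := by
        have := norm_sub_le x (x - y)
        rw [sub_sub_cancel] at this
        linarith
      refine mul_le_mul (mul_le_mul_of_nonneg_left (sqrt_le_radialMajorant hC hyx) hcpos.le)
        (Real.exp_le_exp.2 ?_) (Real.exp_pos _).le (hnn y)
      nlinarith [Real.pi_pos, pow_le_one₀ (n := 2) (norm_nonneg (x - y)) hxy]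
    have h2 : ∫ y in Metric.closedBall x 1, h y * Real.exp (-Real.pi * ‖x - y‖ ^ 2) ≤ l x :=
      setIntegral_le_integral hint
        (.of_forall fun y => mul_nonneg (hnn y) (Real.exp_pos _).le)
    have h3 : volume.real (Metric.closedBall x 1) = V := by
      rw [hV, Measure.real, Measure.real, Measure.addHaar_closedBall_center]
    rw [h3] at h1
    refine le_trans (le_of_eq ?_) (h1.trans h2)
    rw [smul_eq_mul, hc, Real.exp_neg]
    field_simp
  calc ‖k x‖ = √‖k x‖ ^ 2 := (Real.sq_sqrt (norm_nonneg _)).symm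
    _ ≤ l x ^ 2 := by gcongr

end UltraMult

end

open UltraMult
open scoped NNReal ENNReal
theorem theorem3p2 (N : ℕ) (ω : ℝ → ℝ) (hω : IsNonquasianalyticWeight ω) :
    -- `O_{M,ω}(ℝ^N)` is a locally convex Hausdorff space
    (IsTopologicalAddGroup (OM N ω) ∧ ContinuousSMul ℂ (OM N ω) ∧
      LocallyConvexSpace ℝ (OM N ω) ∧ T2Space (OM N ω)) ∧
    -- pointwise multiplication is a well-defined associative bilinear map, jointly continuous
    (∃ mul : OM N ω →ₗ[ℂ] OM N ω →ₗ[ℂ] OM N ω,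
      (∀ (f g : OM N ω) (x : E N), mul f g x = f x * g x) ∧
      (∀ f g h : OM N ω, mul (mul f g) h = mul f (mul g h)) ∧
      Continuous (fun p : OM N ω × OM N ω => mul p.1 p.2)) ∧
    -- the `q_{m,k}` are finite on `O_{M,ω}(ℝ^N)`
    (∀ (m : ℕ+) (k : E N → ℂ), MemS ω k → ∀ f : OM N ω, q ω m k f < ∞) ∧
    -- every `k ∈ S_ω` satisfies `|k| ≤ l²` for some `0 ≤ l ∈ S_ω`
    (∀ k : E N → ℂ, MemS ω k → ∃ l : E N → ℝ,
      MemS ω (fun x => (l x : ℂ)) ∧ ∀ x, 0 ≤ l x ∧ ‖k x‖ ≤ l x ^ 2) ∧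
    -- the estimate `q_{m,k}(fg) ≤ C q_{m',l}(f) q_{m',l}(g)`
    (∀ m : ℕ+, ∃ (m' : ℕ+) (C : ℝ≥0), ∀ (k : E N → ℂ) (l : E N → ℝ), MemS ω k →
      MemS ω (fun x => (l x : ℂ)) → (∀ x, ‖k x‖ ≤ l x ^ 2) →
      ∀ f g : OM N ω, q ω m k (fun x => f x * g x) ≤
        C * q ω m' (fun x => (l x : ℂ)) f * q ω m' (fun x => (l x : ℂ)) g) := by
  refine ⟨⟨inferInstance, inferInstance, inferInstance, t2Space_OM hω.nonneg⟩,
    exists_OM_mul hω, fun m k hk f => q_lt_top hω.nonneg m hk f,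
    fun k hk => exists_norm_le_sq hω hk, fun m => ?_⟩
  obtain ⟨m', C, h⟩ := exists_q_mul_le (N := N) hω m
  exact ⟨m', C, fun k l _ _ hkl f g =>
    h k l hkl f.1 g.1 (f.contDiff hω.nonneg) (g.contDiff hω.nonneg)⟩
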